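/- **Setting.** A projective configuration $C=(\mathcal L,\mathcal P,\succ)$ consists of a set $\mathcal L$ of lines, a set $\mathcal P$ of points and an incidence relation such that any two distinct lines have exactly one common point and every point lies on at least two lines. Let $C$ be non-degenerate ($|\mathcal P|>1$) with finitely many lines $l_0,l_1,\dots,l_n$, and let $\mathcal P_0$ be the set of points not on $l_0$. Let $F$ be the free group on $w_1,\dots,w_n$, let $\gamma_1\Gamma=\Gamma$, $\gamma_{k+1}\Gamma=[\Gamma,\gamma_k\Gamma]$ be the lower central series of a group $\Gamma$, let $L_k=\gamma_kF/\gamma_{k+1}F$ be the graded pieces of the associated graded Lie ring, $H=L_1$, and let $x_i\in H$ be the class of $w_i$. Let $I$ be the set of pairs $(i,p)$ with $p\in\mathcal P_0$, $1\le i\le n$, $l_i\succ p$ and $i\ne\min\{j: l_j\succ p\}$, and put $\bar r(i,p)=[x_i,\sum_{j:\,l_j\succ p}x_j]\in L_2$. A family $\mathcal R=(r(i,p))_{(i,p)\in I}$ of elements of $\gamma_2F$ is called admissible if the image of $r(i,p)$ in $L_2$ is $\bar r(i,p)$ for all $(i,p)\in I$. Let $R_2\subseteq L_2$ be the subgroup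 generated by the $\bar r(i,p)$, $R_3=[H,R_2]\subseteq L_3$, $P_2=L_2/R_2$, $P_3=L_3/R_3$. For $G=F/\langle\mathcal R\rangle$ with $\mathcal R$ admissible, $\langle\mathcal R\rangle$ being the normal closure, there are canonical isomorphisms $G/\gamma_2G\cong H$, $\gamma_2G/\gamma_3G\cong P_2$, $\gamma_3G/\gamma_4G\cong P_3$. Let $M=P_3\oplus P_2$ with the $H$-action $h\cdot(a,b)=(a+[h,b],b)$; it is an extension of the trivial $H$-module $P_2$ by the trivial $H$-module $P_3$. The group $\mathrm{Hom}(P_2,P_3)$ acts on $M$ by the automorphisms $(a,b)\mapsto(a+f(b),b)$. Let $$\mathrm{Hom}(H,P_2)=H^1(H,P_2)\xrightarrow{\ \delta\ }H^2(H,P_3)\xrightarrow{\ \alpha\ }H^2(H,M)\xrightarrow{\ \beta\ }H^2(H,P_2)$$ be part of the long exact sequence in group cohomology. For a trivial $H$-module $A$, identify $H^2(H,A)$ with $\mathrm{Hom}(L_2,A)$, the class of a cocycle $c$ corresponding to $[x,y]\mapsto c(x,y)-c(y,x)$. Let $\chi_2\in H^2(H,P_2)$ correspond to the projection $L_2\to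 P_2$, let $\bar\delta:\mathrm{Hom}(H,P_2)\to\mathrm{Hom}(R_2,P_3)$ be $\delta$ followed by restriction to $R_2$, and put $$Y=\beta^{-1}(\chi_2)/\mathrm{Hom}(P_2,P_3),\qquad T=\mathrm{Hom}(R_2,P_3)/\bar\delta\,\mathrm{Hom}(H,P_2).$$ An element $t\in T$ translates $y\in Y$ to $y'\in Y$ if there are representatives $\chi$ of $y$, $\chi'$ of $y'$ and a class $\psi\in H^2(H,P_3)$ with $\chi'=\chi+\alpha(\psi)$ such that $t$ is the class of $\psi|_{R_2}$. For admissible $\mathcal R$, choose an isomorphism of $H$-modules $\gamma_2G/\gamma_4G\cong M$ compatible with the canonical isomorphisms $\gamma_3G/\gamma_4G\cong P_3$ and $\gamma_2G/\gamma_3G\cong P_2$, and let $\bar\chi_3(\mathcal R)\in Y$ be the orbit of the class in $H^2(H,M)$ of the extension $1\to M\to G/\gamma_4G\to H\to1$. **Theorem 2.1.** Translation makes $Y$ a principal homogeneous space over $T$. Let $\mathcal R,\mathcal R'$ be admissible for $C$, and let $G=F/\langle\mathcal R\rangle$, $G'=F/\langle\mathcal R'\rangle$. Then $\bar\chi_3(\mathcal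 R)$ and $\bar\chi_3(\mathcal R')$ are well-defined elements of $Y$, so that $\kappa(\mathcal R,\mathcal R')=\bar\chi_3(\mathcal R)-\bar\chi_3(\mathcal R')\in T$ is well defined; and an isomorphism $G/\gamma_4G\to G'/\gamma_4G'$ extending the canonical isomorphism $G/\gamma_2G\cong H\cong G'/\gamma_2G'$ exists if and only if $\kappa(\mathcal R,\mathcal R')=0$ in $T$. -/

import Mathlib

open scoped commutatorElement

namespace LineArrangement

/-- `gr G j` is the quotient of the `(j+1)`-st by the `(j+2)`-nd term of the lower central series of
`G`, written additively. Mathlib numbers the series from zero: `lowerCentralSeries ⊤ 0` is `G` and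
`lowerCentralSeries ⊤ j` is the group usually called `γ_{j+1} G`. -/
abbrev GrQuot (G : Type*) [Group G] (j : ℕ) : Type _ :=
  ↥((⊤ : Subgroup G).lowerCentralSeries j) ⧸
    ((⊤ : Subgroup G).lowerCentralSeries (j + 1)).subgroupOf
      ((⊤ : Subgroup G).lowerCentralSeries j)

theorem commutator_mem_lcs {G : Type*} [Group G] {j : ℕ} (x : G) {u : G}
    (hu : u ∈ (⊤ : Subgroup G).lowerCentralSeries j) :
    ⁅x, u⁆ ∈ (⊤ : Subgroup G).lowerCentralSeries (j + 1) := by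
  rw [Subgroup.lowerCentralSeries_succ, Subgroup.commutator_comm]
  exact Subgroup.commutator_mem_commutator (Subgroup.mem_top x) hu

theorem grQuot_mul_comm {G : Type*} [Group G] (j : ℕ) (a b : GrQuot G j) : a * b = b * a := by
  induction a using QuotientGroup.induction_on with | H a =>
  induction b using QuotientGroup.induction_on with | H b =>
  rw [← QuotientGroup.mk_mul, ← QuotientGroup.mk_mul, QuotientGroup.eq, Subgroup.mem_subgroupOf]
  have h := commutator_mem_lcs (b : G)⁻¹ (inv_mem a.2)
  have e : (((a * b)⁻¹ * (b * a) : _) : G) = ⁅(b : G)⁻¹, (a : G)⁻¹⁆ := by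
    simp [commutatorElement_def, mul_assoc]
  rw [← e] at h
  exact h

instance (G : Type*) [Group G] (j : ℕ) : CommGroup (GrQuot G j) :=
  { (inferInstance : Group (GrQuot G j)) with mul_comm := grQuot_mul_comm j }

/-- The graded piece `gr_{j+1} G = γ_{j+1} G / γ_{j+2} G` of the lower central series, written
additively (Mathlib numbers the lower central series from zero). -/
abbrev Gr (G : Type*) [Group G] (j : ℕ) : Type _ := Additive (GrQuot G j)

/-- The class in `gr_{j+1} G` of an element `u` of `γ_{j+1} G`. -/
def Gr.mk {G : Type*} [Group G] {j : ℕ} (u : G)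
    (hu : u ∈ (⊤ : Subgroup G).lowerCentralSeries j) : Gr G j :=
  Additive.ofMul (QuotientGroup.mk ⟨u, hu⟩)

theorem Gr.mk_mul {G : Type*} [Group G] {j : ℕ} {u v : G}
    (hu : u ∈ (⊤ : Subgroup G).lowerCentralSeries j)
    (hv : v ∈ (⊤ : Subgroup G).lowerCentralSeries j) :
    Gr.mk (u * v) (mul_mem hu hv) = Gr.mk u hu + Gr.mk v hv := rfl

theorem Gr.mk_eq_iff {G : Type*} [Group G] {j : ℕ} {u v : G}
    (hu : u ∈ (⊤ : Subgroup G).lowerCentralSeries j)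
    (hv : v ∈ (⊤ : Subgroup G).lowerCentralSeries j) :
    Gr.mk u hu = Gr.mk v hv ↔ u⁻¹ * v ∈ (⊤ : Subgroup G).lowerCentralSeries (j + 1) := by
  unfold Gr.mk
  rw [Additive.ofMul.injective.eq_iff, QuotientGroup.eq, Subgroup.mem_subgroupOf]
  rfl

theorem Gr.exists_mk {G : Type*} [Group G] {j : ℕ} (x : Gr G j) :
    ∃ u, ∃ hu : u ∈ (⊤ : Subgroup G).lowerCentralSeries j, Gr.mk u hu = x := by
  obtain ⟨⟨u, hu⟩, h⟩ := QuotientGroup.mk_surjective (Additive.toMul x)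
  exact ⟨u, hu, by unfold Gr.mk; rw [h]; rfl⟩

theorem Gr.mk_commutator_mul_right {G : Type*} [Group G] {j : ℕ} (x : G) {u v : G}
    (hu : u ∈ (⊤ : Subgroup G).lowerCentralSeries j)
    (hv : v ∈ (⊤ : Subgroup G).lowerCentralSeries j) :
    Gr.mk ⁅x, u * v⁆ (commutator_mem_lcs x (mul_mem hu hv)) =
      Gr.mk ⁅x, u⁆ (commutator_mem_lcs x hu) + Gr.mk ⁅x, v⁆ (commutator_mem_lcs x hv) := by
  rw [← Gr.mk_mul, Gr.mk_eq_iff]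
  have h := commutator_mem_lcs u (inv_mem (commutator_mem_lcs x hv))
  have e : ⁅x, u * v⁆⁻¹ * (⁅x, u⁆ * ⁅x, v⁆) = ⁅u, ⁅x, v⁆⁻¹⁆ := by
    simp only [commutatorElement_def]; group
  rw [e]; exact h

theorem Gr.mk_commutator_mul_left {G : Type*} [Group G] {j : ℕ} (x y : G) {u : G}
    (hu : u ∈ (⊤ : Subgroup G).lowerCentralSeries j) :
    Gr.mk ⁅x * y, u⁆ (commutator_mem_lcs (x * y) hu) =
      Gr.mk ⁅x, u⁆ (commutator_mem_lcs x hu) + Gr.mk ⁅y, u⁆ (commutator_mem_lcs y hu) := by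
  rw [add_comm (Gr.mk ⁅x, u⁆ _), ← Gr.mk_mul, Gr.mk_eq_iff]
  have h2 := commutator_mem_lcs x (inv_mem (commutator_mem_lcs y hu))
  have h3 : ⁅x, u⁆⁻¹ * ⁅x, ⁅y, u⁆⁻¹⁆ * ⁅x, u⁆ ∈
      (⊤ : Subgroup G).lowerCentralSeries (j + 1 + 1) := by
    have := (inferInstance : ((⊤ : Subgroup G).lowerCentralSeries (j + 1 + 1)).Normal).conj_mem
      _ h2 ⁅x, u⁆⁻¹
    simpa using this
  have e : ⁅x * y, u⁆⁻¹ * (⁅y, u⁆ * ⁅x, u⁆) = ⁅x, u⁆⁻¹ * ⁅x, ⁅y, u⁆⁻¹⁆ * ⁅x, u⁆ := by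
    simp only [commutatorElement_def]; group
  rw [e]; exact h3

/-- Commutation with a fixed `x`, as a homomorphism `gr_{j+1} G → gr_{j+2} G`. -/
def adHom (G : Type*) [Group G] (j : ℕ) (x : G) : Gr G j →+ Gr G (j + 1) :=
  MonoidHom.toAdditive <| QuotientGroup.lift _
    (MonoidHom.mk' (fun u : ↥((⊤ : Subgroup G).lowerCentralSeries j) =>
      (Gr.mk ⁅x, (u : G)⁆ (commutator_mem_lcs x u.2)).toMul)
      (fun u v => congrArg Additive.toMul (Gr.mk_commutator_mul_right x u.2 v.2)))
    (fun u hu => by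
      have h := commutator_mem_lcs x (Subgroup.mem_subgroupOf.1 hu)
      have h1 : Gr.mk ⁅x, (u : G)⁆ (commutator_mem_lcs x u.2) = Gr.mk 1 (one_mem _) :=
        ((Gr.mk_eq_iff (one_mem _) (commutator_mem_lcs x u.2)).2 (by simpa using h)).symm
      exact congrArg Additive.toMul h1)

theorem adHom_mk {G : Type*} [Group G] {j : ℕ} (x : G) {u : G}
    (hu : u ∈ (⊤ : Subgroup G).lowerCentralSeries j) :
    adHom G j x (Gr.mk u hu) = Gr.mk ⁅x, u⁆ (commutator_mem_lcs x hu) := rfl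

/-- The Lie bracket `gr_1 G × gr_{j+1} G → gr_{j+2} G` of the associated graded Lie ring, induced
by the group commutator; here `gr_1 G` is taken to be the abelianization of `G`. -/
def bracket (G : Type*) [Group G] (j : ℕ) :
    Additive (Abelianization G) →+ Gr G j →+ Gr G (j + 1) :=
  MonoidHom.toAdditiveLeft <| Abelianization.lift
    (MonoidHom.mk' (fun x : G => Multiplicative.ofAdd (adHom G j x)) (fun x y => by
      apply Multiplicative.toAdd.injective
      refine AddMonoidHom.ext fun a => ?_
      obtain ⟨u, hu, rfl⟩ := Gr.exists_mk a
      exact Gr.mk_commutator_mul_left x y hu))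

theorem bracket_mk {G : Type*} [Group G] {j : ℕ} (x : G) {u : G}
    (hu : u ∈ (⊤ : Subgroup G).lowerCentralSeries j) :
    bracket G j (Additive.ofMul (Abelianization.of x)) (Gr.mk u hu) =
      Gr.mk ⁅x, u⁆ (commutator_mem_lcs x hu) := rfl


/-- A projective configuration with set of lines `L` and set of points `P`. -/
structure ProjectiveConfiguration (L P : Type*) where
  /-- The incidence relation: `Inc l p` means that the line `l` passes through the point `p`. -/
  Inc : L → P → Prop
  /-- Any two distinct lines have a unique common point. -/
  existsUnique_point : ∀ l l' : L, l ≠ l' → ∃! p, Inc l p ∧ Inc l' p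
  /-- Any point lies on at least two lines. -/
  exists_two_lines : ∀ p : P, ∃ l l' : L, l ≠ l' ∧ Inc l p ∧ Inc l' p

/-- A configuration is non-degenerate if it has more than one point. -/
def ProjectiveConfiguration.NonDegenerate {L P : Type*} (_C : ProjectiveConfiguration L P) : Prop :=
  Nontrivial P

/-- The free group `F` on `w_1, …, w_n`; the generator `w_{i+1}` is `FreeGroup.of i`. -/
abbrev F (n : ℕ) : Type := FreeGroup (Fin n)

/-- The group `H = gr_1 F = F / γ_2 F`, in multiplicative notation. -/
abbrev H (n : ℕ) : Type := Abelianization (F n)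

theorem rep_exact_of_forall {k G : Type} [CommRing k] [Group G]
    (S : CategoryTheory.ShortComplex (Rep.{0} k G))
    (h : ∀ m : S.X₂, S.g.hom m = 0 → ∃ a : S.X₁, S.f.hom a = m) : S.Exact :=
  (CategoryTheory.forget₂ (Rep.{0} k G) (ModuleCat k)).reflects_exact_of_faithful _ <|
    (CategoryTheory.ShortComplex.moduleCat_exact_iff _).2 h

section Configuration

open CategoryTheory

variable {L P : Type*} {n : ℕ} (C : ProjectiveConfiguration L P) (l : Fin (n + 1) ≃ L)

/-- The index set of the relators, for lines enumerated as `l_0, …, l_n` with `l_0` the line at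
infinity: the pairs `(i, p)` with `1 ≤ i ≤ n`, `p` not on `l_0`, `p` on `l_i`, and `i` not the least
index of a line through `p`. The index `i : Fin n` stands for the line `l_{i+1}`. -/
abbrev RelatorIndex : Type _ :=
  {s : Fin n × P // ¬ C.Inc (l 0) s.2 ∧ C.Inc (l s.1.succ) s.2 ∧
    ¬ IsLeast {j : Fin n | C.Inc (l j.succ) s.2} s.1}

/-- The class `x_{i+1}` of the generator `w_{i+1}` in `H`. -/
def xH {n : ℕ} (i : Fin n) : Additive (H n) := Additive.ofMul (Abelianization.of (FreeGroup.of i))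

/-- The class `x_{i+1}` of the generator `w_{i+1}` in `gr_1 F`. -/
def xGr {n : ℕ} (i : Fin n) : Gr (F n) 0 := Gr.mk (FreeGroup.of i) (Subgroup.mem_top _)

open Classical in
/-- The element `r̄(i, p) = [x_i, ∑_{j : p ∈ l_j} x_j]` of `L_2 = gr_2 F`. -/
noncomputable def rBar (s : RelatorIndex C l) : Gr (F n) 1 :=
  bracket (F n) 0 (xH s.1.1) (∑ j : Fin n with C.Inc (l j.succ) s.1.2, xGr j)

/-- A family of relators is admissible if each `r(i, p)` lies in `γ_2 F` and has image `r̄(i, p)`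
in `gr_2 F`. -/
def IsAdmissible (r : RelatorIndex C l → F n) : Prop :=
  ∀ s, ∃ h : r s ∈ (⊤ : Subgroup (F n)).lowerCentralSeries 1, Gr.mk (r s) h = rBar C l s

/-- The subgroup `R_2` of `L_2 = gr_2 F` generated by the elements `r̄(i, p)`. -/
noncomputable def R2 : AddSubgroup (Gr (F n) 1) := AddSubgroup.closure (Set.range (rBar C l))

/-- The subgroup `R_3 = [H, R_2]` of `L_3 = gr_3 F`. -/
noncomputable def R3 : AddSubgroup (Gr (F n) 2) :=
  AddSubgroup.closure {z | ∃ h : Additive (H n), ∃ x ∈ R2 C l, bracket (F n) 1 h x = z}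

/-- `P_2 = L_2 / R_2`. -/
abbrev P2 : Type := Gr (F n) 1 ⧸ R2 C l

/-- `P_3 = L_3 / R_3`. -/
abbrev P3 : Type := Gr (F n) 2 ⧸ R3 C l

/-- The Lie bracket `H × P_2 → P_3`. -/
noncomputable def bracketP : Additive (H n) →+ P2 C l →+ P3 C l :=
  AddMonoidHom.mk' (fun h => QuotientAddGroup.map (R2 C l) (R3 C l) (bracket (F n) 1 h)
      (fun x hx => AddSubgroup.subset_closure ⟨h, x, hx, rfl⟩))
    (fun h h' => by
      refine AddMonoidHom.ext fun b => ?_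
      induction b using QuotientAddGroup.induction_on with | H x =>
      change QuotientAddGroup.mk (bracket (F n) 1 (h + h') x) = _
      rw [map_add]
      rfl)

/-- The `H`-module structure on `P_3 × P_2` given by `h · (a, b) = (a + [h, b], b)`. -/
noncomputable def repM : Representation ℤ (H n) (P3 C l × P2 C l) where
  toFun h := AddMonoidHom.toIntLinearMap
    (AddMonoidHom.mk' (fun m : P3 C l × P2 C l => (m.1 + bracketP C l (Additive.ofMul h) m.2, m.2))
      (fun m m' => by
        ext
        · simp only [Prod.fst_add, Prod.snd_add, map_add]; abel
        · rfl))
  map_one' := by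
    refine LinearMap.ext fun m => ?_
    change (m.1 + bracketP C l (Additive.ofMul 1) m.2, m.2) = m
    simp
  map_mul' h h' := by
    refine LinearMap.ext fun m => ?_
    change (m.1 + bracketP C l (Additive.ofMul (h * h')) m.2, m.2) =
      (m.1 + bracketP C l (Additive.ofMul h') m.2 + bracketP C l (Additive.ofMul h) m.2, m.2)
    rw [ofMul_mul, map_add, AddMonoidHom.add_apply]
    ext
    · simp only; abel
    · rfl

/-- The `H`-module `M` (up to the action of `Hom(P_2, P_3)`). As an extension of `P_2` by `P_3` in
which `h - 1` acts as `[h, ·]`, it is the direct sum `P_3 ⊕ P_2` with this twisted action, because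
`P_2` is a free abelian group. -/
noncomputable abbrev M : Rep ℤ (H n) := Rep.of (repM C l)

/-- `P_2` as a trivial `H`-module. -/
noncomputable abbrev repP2 : Rep ℤ (H n) := Rep.trivial ℤ (H n) (P2 C l)

/-- `P_3` as a trivial `H`-module. -/
noncomputable abbrev repP3 : Rep ℤ (H n) := Rep.trivial ℤ (H n) (P3 C l)

/-- The inclusion `P_3 → M` of `H`-modules. -/
noncomputable def inclM : repP3 C l ⟶ M C l :=
  Rep.ofHom (LinearMap.intertwiningMap_of_isIntertwiningMap _ _
    (LinearMap.inl ℤ (P3 C l) (P2 C l)) (fun h a => by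
      change (a, (0 : P2 C l)) = (a + bracketP C l (Additive.ofMul h) 0, 0)
      simp))

/-- The projection `M → P_2` of `H`-modules. -/
noncomputable def projM : M C l ⟶ repP2 C l :=
  Rep.ofHom (LinearMap.intertwiningMap_of_isIntertwiningMap _ _
    (LinearMap.snd ℤ (P3 C l) (P2 C l)) (fun _ _ => rfl))

/-- The automorphism `(a, b) ↦ (a + f b, b)` of the `H`-module `M` attached to `f : P_2 → P_3`. -/
noncomputable def shear (f : P2 C l →+ P3 C l) : M C l ⟶ M C l :=
  Rep.ofHom (LinearMap.intertwiningMap_of_isIntertwiningMap _ _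
    (AddMonoidHom.toIntLinearMap (AddMonoidHom.mk'
      (fun m : P3 C l × P2 C l => (m.1 + f m.2, m.2)) (fun m m' => by
        ext
        · simp only [Prod.fst_add, Prod.snd_add, map_add]; abel
        · rfl)))
    (fun h m => by
      change (m.1 + bracketP C l (Additive.ofMul h) m.2 + f m.2, m.2) =
        (m.1 + f m.2 + bracketP C l (Additive.ofMul h) m.2, m.2)
      ext
      · simp only; abel
      · rfl))

theorem shear_zero : shear C l 0 = 𝟙 (M C l) := by
  refine Rep.hom_ext (DFunLike.ext _ _ fun m => ?_)
  change (m.1 + 0, m.2) = m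
  rw [add_zero]

theorem shear_add (f g : P2 C l →+ P3 C l) :
    shear C l (f + g) = shear C l g ≫ shear C l f := by
  refine Rep.hom_ext (DFunLike.ext _ _ fun m => ?_)
  change (m.1 + (f m.2 + g m.2), m.2) = (m.1 + g m.2 + f m.2, m.2)
  ext
  · simp only; abel
  · rfl

/-- The short exact sequence `0 → P_3 → M → P_2 → 0` of `H`-modules. -/
noncomputable def seqM : ShortComplex (Rep ℤ (H n)) where
  f := inclM C l
  g := projM C l
  zero := by
    ext a
    rfl

theorem seqM_shortExact : (seqM C l).ShortExact where
  exact := rep_exact_of_forall _ fun m hm =>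
    ⟨Prod.fst (α := P3 C l) (β := P2 C l) m, Prod.ext rfl (Eq.symm hm)⟩
  mono_f := (Rep.mono_iff_injective _).2 fun _ _ h => congrArg Prod.fst h
  epi_g := (Rep.epi_iff_surjective _).2 fun b => ⟨((0 : P3 C l), b), rfl⟩

end Configuration

section CommutatorForm

open groupCohomology

variable {n : ℕ} {A : Type} [AddCommGroup A]

theorem exists_primitive (c : cocycles₂ (Rep.trivial ℤ (H n) A)) :
    ∃ f : F n → A, ∀ u v : F n,
      f (u * v) = f u + f v + c (Abelianization.of u, Abelianization.of v) := by
  have hc : ∀ x y z : H n, c (x * y, z) + c (x, y) = c (y, z) + c (x, y * z) := fun x y z =>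
    (mem_cocycles₂_iff c.1).1 c.2 x y z
  have h1 : ∀ x : H n, c (1, x) = c (1, 1) := cocycles₂_map_one_fst c
  -- the translations `(a, x) ↦ (a₀ + a + c (x₀, x), x₀ x)` of `A × H`
  let T : A → H n → Equiv.Perm (A × H n) := fun a₀ x₀ =>
    { toFun := fun s => (a₀ + s.1 + c (x₀, s.2), x₀ * s.2)
      invFun := fun s => (s.1 - a₀ - c (x₀, x₀⁻¹ * s.2), x₀⁻¹ * s.2)
      left_inv := fun s => by
        ext
        · simp only [inv_mul_cancel_left]; abel
        · simp
      right_inv := fun s => by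
        ext
        · simp only; abel
        · simp }
  have hT : ∀ a₀ x₀ s, T a₀ x₀ s = (a₀ + s.1 + c (x₀, s.2), x₀ * s.2) := fun _ _ _ => rfl
  have hmul : ∀ a x b y, T a x * T b y = T (a + b + c (x, y)) (x * y) := by
    intro a x b y
    refine Equiv.ext fun s => ?_
    rw [Equiv.Perm.mul_apply, hT, hT, hT]
    refine Prod.ext ?_ (mul_assoc _ _ _).symm
    have := hc x y s.2
    simp only
    have e : c (x, y * s.2) = c (x * y, s.2) + c (x, y) - c (y, s.2) := by rw [this]; abel
    rw [e]; abel
  have hone : T (-c (1, 1)) 1 = 1 := by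
    refine Equiv.ext fun s => ?_
    rw [hT, h1 s.2]
    refine Prod.ext ?_ (one_mul _)
    rw [Equiv.Perm.one_apply]; simp only; abel
  have hinj : ∀ a b x y, T a x = T b y → a = b := by
    intro a b x y h
    have h2 := congrArg (fun e => e ((0 : A), (1 : H n))) h
    simp only [hT, mul_one, Prod.mk.injEq] at h2
    rw [h2.2] at h2
    simpa using h2.1
  let Φ : F n →* Equiv.Perm (A × H n) := FreeGroup.lift fun i => T 0 (Abelianization.of (.of i))
  have hΦ : ∀ w : F n, ∃ a, Φ w = T a (Abelianization.of w) := by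
    intro w
    induction w using FreeGroup.induction_on with
    | C1 => exact ⟨-c (1, 1), by rw [map_one, map_one, hone]⟩
    | of i => exact ⟨0, by simp [Φ]⟩
    | inv_of i ih =>
      obtain ⟨a, ha⟩ := ih
      refine ⟨-c (1, 1) - a - c (Abelianization.of (FreeGroup.of i),
        (Abelianization.of (FreeGroup.of i))⁻¹), ?_⟩
      rw [map_inv, ha, inv_eq_iff_mul_eq_one, map_inv, hmul, mul_inv_cancel, ← hone]
      congr 1
      abel
    | mul u v hu hv =>
      obtain ⟨a, ha⟩ := hu
      obtain ⟨b, hb⟩ := hv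
      exact ⟨a + b + c (Abelianization.of u, Abelianization.of v), by
        rw [map_mul, ha, hb, hmul, map_mul]⟩
  choose f hf using hΦ
  refine ⟨f, fun u v => hinj _ _ (Abelianization.of (u * v)) (Abelianization.of (u * v)) ?_⟩
  rw [← hf, map_mul, map_mul, ← hmul, hf, hf]

theorem abelianization_of_eq_one {u : F n} (hu : u ∈ (⊤ : Subgroup (F n)).lowerCentralSeries 1) :
    Abelianization.of u = (1 : H n) :=
  (QuotientGroup.eq_one_iff u).2 hu

theorem existsUnique_commutatorForm (c : cocycles₂ (Rep.trivial ℤ (H n) A)) :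
    ∃! φ : Gr (F n) 1 →+ A, ∀ u v : F n,
      φ (Gr.mk ⁅u, v⁆ (commutator_mem_lcs u (Subgroup.mem_top v))) =
        c (Abelianization.of u, Abelianization.of v) -
          c (Abelianization.of v, Abelianization.of u) := by
  have h1 : ∀ x : H n, c (1, x) = c (1, 1) := cocycles₂_map_one_fst c
  have h2 : ∀ x : H n, c (x, 1) = c (1, 1) := cocycles₂_map_one_snd c
  obtain ⟨f, hf⟩ := exists_primitive c
  have hcomm : ∀ u v : F n, f ⁅u, v⁆ + c (1, 1) = c (Abelianization.of u, Abelianization.of v) -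
          c (Abelianization.of v, Abelianization.of u) := by
    intro u v
    have e : ⁅u, v⁆ * (v * u) = u * v := by simp [commutatorElement_def, mul_assoc]
    have := hf ⁅u, v⁆ (v * u)
    rw [e, hf u v, hf v u, abelianization_of_eq_one
      (commutator_mem_lcs u (Subgroup.mem_top v)), h1] at this
    have h3 : f ⁅u, v⁆ + c (1, 1) = (f u + f v + c (Abelianization.of u, Abelianization.of v)) -
        (f v + f u + c (Abelianization.of v, Abelianization.of u)) := by rw [this]; abel
    rw [h3]; abel
  let g : ↥((⊤ : Subgroup (F n)).lowerCentralSeries 1) →* Multiplicative A :=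
    MonoidHom.mk' (fun u => Multiplicative.ofAdd (f u + c (1, 1))) (fun u v => by
      rw [← ofAdd_add]
      congr 1
      rw [Subgroup.coe_mul, hf, abelianization_of_eq_one u.2, h1]
      abel)
  have hg : ((⊤ : Subgroup (F n)).lowerCentralSeries 2).subgroupOf
      ((⊤ : Subgroup (F n)).lowerCentralSeries 1) ≤ g.ker := by
    have key : (⊤ : Subgroup (F n)).lowerCentralSeries 2 ≤
        g.ker.map ((⊤ : Subgroup (F n)).lowerCentralSeries 1).subtype := by
      refine Subgroup.commutator_le.2 fun u hu v _ => ?_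
      have hm : ⁅u, v⁆ ∈ (⊤ : Subgroup (F n)).lowerCentralSeries 1 :=
        commutator_mem_lcs u (Subgroup.mem_top v)
      refine ⟨⟨⁅u, v⁆, hm⟩, ?_, rfl⟩
      change Multiplicative.ofAdd (f ⁅u, v⁆ + c (1, 1)) = 1
      rw [hcomm, abelianization_of_eq_one hu, h1, h2 (Abelianization.of v)]
      exact congrArg Multiplicative.ofAdd (sub_self _)
    intro u hu
    obtain ⟨w, hw, hwu⟩ := key (Subgroup.mem_subgroupOf.1 hu)
    rwa [Subtype.ext hwu] at hw
  refine ⟨MonoidHom.toAdditiveLeft (QuotientGroup.lift _ g hg), fun u v => hcomm u v, ?_⟩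
  intro ψ hψ
  have key : ∀ φ₁ φ₂ : Gr (F n) 1 →+ A, (∀ u v : F n,
      φ₁ (Gr.mk ⁅u, v⁆ (commutator_mem_lcs u (Subgroup.mem_top v))) =
      φ₂ (Gr.mk ⁅u, v⁆ (commutator_mem_lcs u (Subgroup.mem_top v)))) → φ₁ = φ₂ := by
    intro φ₁ φ₂ h
    refine AddMonoidHom.ext fun x => ?_
    obtain ⟨u, hu, rfl⟩ := Gr.exists_mk x
    refine Subgroup.closure_induction (p := fun x hx => φ₁ (Gr.mk (j := 1) x hx) =
      φ₂ (Gr.mk (j := 1) x hx)) ?_ ?_ ?_ ?_ hu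
    · rintro x ⟨p, -, q, -, rfl⟩
      exact h p q
    · exact (map_zero φ₁).trans (map_zero φ₂).symm
    · intro x y hx hy ihx ihy
      have e := Gr.mk_mul (j := 1) hx hy
      exact ((congrArg φ₁ e).trans (map_add φ₁ _ _)).trans
        ((congrArg₂ (· + ·) ihx ihy).trans ((congrArg φ₂ e).trans (map_add φ₂ _ _)).symm)
    · intro x hx ih
      exact (map_neg φ₁ _).trans ((congrArg Neg.neg ih).trans (map_neg φ₂ _).symm)
  exact key _ _ fun u v => (hψ u v).trans (hcomm u v).symm

/-- For a 2-cocycle `c` of `H` with values in a trivial module `A`, the homomorphism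
`L_2 = gr_2 F → A` with `[x, y] ↦ c (x, y) - c (y, x)`. -/
noncomputable def cocycleForm (c : cocycles₂ (Rep.trivial ℤ (H n) A)) : Gr (F n) 1 →+ A :=
  (existsUnique_commutatorForm c).choose

theorem cocycleForm_commutator (c : cocycles₂ (Rep.trivial ℤ (H n) A)) (u v : F n) :
    cocycleForm c (Gr.mk ⁅u, v⁆ (commutator_mem_lcs u (Subgroup.mem_top v))) =
      c (Abelianization.of u, Abelianization.of v) - c (Abelianization.of v, Abelianization.of u) :=
  (existsUnique_commutatorForm c).choose_spec.1 u v

theorem cocycleForm_eq {c : cocycles₂ (Rep.trivial ℤ (H n) A)} {φ : Gr (F n) 1 →+ A}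
    (h : ∀ u v : F n, φ (Gr.mk ⁅u, v⁆ (commutator_mem_lcs u (Subgroup.mem_top v))) =
      c (Abelianization.of u, Abelianization.of v) -
        c (Abelianization.of v, Abelianization.of u)) : cocycleForm c = φ :=
  ((existsUnique_commutatorForm c).choose_spec.2 φ h).symm

theorem cocycleForm_add (c d : cocycles₂ (Rep.trivial ℤ (H n) A)) :
    cocycleForm (c + d) = cocycleForm c + cocycleForm d :=
  cocycleForm_eq fun u v => by
    rw [AddMonoidHom.add_apply, cocycleForm_commutator, cocycleForm_commutator]
    change _ = (c _ + d _) - (c _ + d _)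
    abel

theorem cocycleForm_congr {c d : cocycles₂ (Rep.trivial ℤ (H n) A)}
    (h : H2π _ c = H2π _ d) : cocycleForm c = cocycleForm d := by
  obtain ⟨x, hx⟩ := (H2π_eq_iff c d).1 h
  have hx' : ∀ a b : H n, x b - x (a * b) + x a = c (a, b) - d (a, b) := fun a b =>
    congrFun hx (a, b)
  refine cocycleForm_eq fun u v => ?_
  rw [cocycleForm_commutator]
  have e1 := hx' (Abelianization.of u) (Abelianization.of v)
  have e2 := hx' (Abelianization.of v) (Abelianization.of u)
  rw [mul_comm] at e2
  have e3 : c (Abelianization.of u, Abelianization.of v) -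
      c (Abelianization.of v, Abelianization.of u) -
      (d (Abelianization.of u, Abelianization.of v) -
        d (Abelianization.of v, Abelianization.of u)) = 0 := by
    rw [sub_sub_sub_comm, ← e1, ← e2]; abel
  exact (sub_eq_zero.1 e3).symm

/-- The canonical homomorphism `H²(H, A) → Hom(L_2, A)` for a trivial module `A`, sending the class
of a cocycle `c` to `[x, y] ↦ c (x, y) - c (y, x)`. It is the standard isomorphism
`H²(H, A) ≅ Hom(Λ²H, A)` under the identification `Λ²H ≅ L_2`. -/
noncomputable def commutatorForm : H2 (Rep.trivial ℤ (H n) A) →+ (Gr (F n) 1 →+ A) :=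
  AddMonoidHom.mk'
    (fun ψ => cocycleForm ((ModuleCat.epi_iff_surjective (H2π _)).1 inferInstance ψ).choose)
    (fun ψ ψ' => by
      rw [← cocycleForm_add]
      refine cocycleForm_congr ?_
      rw [map_add]
      have h := fun φ : H2 (Rep.trivial ℤ (H n) A) =>
        ((ModuleCat.epi_iff_surjective (H2π _)).1 inferInstance φ).choose_spec
      rw [h, h, h])

theorem commutatorForm_H2π (c : cocycles₂ (Rep.trivial ℤ (H n) A)) (u v : F n) :
    commutatorForm (H2π _ c) (Gr.mk ⁅u, v⁆ (commutator_mem_lcs u (Subgroup.mem_top v))) =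
      c (Abelianization.of u, Abelianization.of v) -
        c (Abelianization.of v, Abelianization.of u) := by
  rw [← cocycleForm_commutator]
  refine DFunLike.congr_fun (cocycleForm_congr ?_) _
  exact ((ModuleCat.epi_iff_surjective (H2π _)).1 inferInstance _).choose_spec

end CommutatorForm

section Invariant

open CategoryTheory groupCohomology

variable {L P : Type*} {n : ℕ} (C : ProjectiveConfiguration L P) (l : Fin (n + 1) ≃ L)

/-- The map `α : H²(H, P_3) → H²(H, M)`. -/
noncomputable def alpha : H2 (repP3 C l) ⟶ H2 (M C l) :=
  (groupCohomology.functor ℤ (H n) 2).map (inclM C l)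

/-- The map `β : H²(H, M) → H²(H, P_2)`. -/
noncomputable def beta : H2 (M C l) ⟶ H2 (repP2 C l) :=
  (groupCohomology.functor ℤ (H n) 2).map (projM C l)

/-- The automorphism of `H²(H, M)` induced by `f : P_2 → P_3`. -/
noncomputable def shearH2 (f : P2 C l →+ P3 C l) : H2 (M C l) ⟶ H2 (M C l) :=
  (groupCohomology.functor ℤ (H n) 2).map (shear C l f)

theorem shearH2_zero : shearH2 C l 0 = 𝟙 (H2 (M C l)) :=
  (congrArg (groupCohomology.functor ℤ (H n) 2).map (shear_zero C l)).trans
    ((groupCohomology.functor ℤ (H n) 2).map_id _)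

theorem shearH2_add (f g : P2 C l →+ P3 C l) :
    shearH2 C l (f + g) = shearH2 C l g ≫ shearH2 C l f :=
  (congrArg (groupCohomology.functor ℤ (H n) 2).map (shear_add C l f g)).trans
    ((groupCohomology.functor ℤ (H n) 2).map_comp _ _)

/-- The connecting homomorphism `δ : Hom(H, P_2) = H¹(H, P_2) → H²(H, P_3)` of the long exact
sequence of `0 → P_3 → M → P_2 → 0`. -/
noncomputable def delta : ModuleCat.of ℤ (Additive (H n) →+ P2 C l) ⟶ H2 (repP3 C l) :=
  (H1IsoOfIsTrivial (repP2 C l)).inv ≫ groupCohomology.δ (seqM_shortExact C l) 1 2 rfl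

/-- Restriction to `R_2` of the homomorphism `L_2 → P_3` given by a class in `H²(H, P_3)`. -/
noncomputable def formOnR2 : H2 (repP3 C l) →+ (R2 C l →+ P3 C l) :=
  (AddMonoidHom.compHom' (R2 C l).subtype).comp commutatorForm

/-- The homomorphism `δ̄ : Hom(H, P_2) → Hom(R_2, P_3)`, the composition of `δ` with restriction
to `R_2`. -/
noncomputable def deltaBar : (Additive (H n) →+ P2 C l) →+ (R2 C l →+ P3 C l) :=
  (formOnR2 C l).comp (delta C l).hom.toAddMonoidHom

/-- The group `T = Hom(R_2, P_3) / δ̄ Hom(H, P_2)`. -/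
abbrev T : Type := (R2 C l →+ P3 C l) ⧸ (deltaBar C l).range

/-- The fibre `β⁻¹(χ_2)`, where `χ_2 ∈ H²(H, P_2) = Hom(L_2, P_2)` is the projection `L_2 → P_2`. -/
abbrev Fibre : Type :=
  {χ : H2 (M C l) // commutatorForm (beta C l χ) = QuotientAddGroup.mk' (R2 C l)}

/-- Two elements of `β⁻¹(χ_2)` are equivalent if they lie in one orbit of `Hom(P_2, P_3)`. -/
noncomputable instance fibreSetoid : Setoid (Fibre C l) where
  r χ χ' := ∃ f : P2 C l →+ P3 C l, shearH2 C l f χ.1 = χ'.1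
  iseqv :=
    { refl := fun χ => ⟨0, by rw [shearH2_zero]; rfl⟩
      symm := by
        rintro χ χ' ⟨f, hf⟩
        refine ⟨-f, ?_⟩
        have e : -f + f = 0 := neg_add_cancel f
        rw [← hf, ← ModuleCat.comp_apply, ← shearH2_add, e, shearH2_zero]
        rfl
      trans := by
        rintro χ χ' χ'' ⟨f, hf⟩ ⟨g, hg⟩
        refine ⟨g + f, ?_⟩
        rw [shearH2_add, ModuleCat.comp_apply, hf, hg] }

/-- The set `Y = β⁻¹(χ_2) / Hom(P_2, P_3)`. -/
def Y : Type := Quotient (fibreSetoid C l)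

/-- The translation action of `T` on `Y`: `IsTranslate C l t y y'` says that `y' = t + y`. This
holds if there are representatives `χ` of `y` and `χ'` of `y'` and a class `ψ ∈ H²(H, P_3)` with
`χ' = χ + α ψ` such that `t` is the class of the restriction of `ψ` to `R_2`. -/
def IsTranslate (t : T C l) (y y' : Y C l) : Prop :=
  ∃ (χ χ' : Fibre C l) (ψ : H2 (repP3 C l)),
    Quotient.mk _ χ = y ∧ Quotient.mk _ χ' = y' ∧ χ'.1 = χ.1 + alpha C l ψ ∧
      t = QuotientAddGroup.mk (formOnR2 C l ψ)

end Invariant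

/-- A relation `Rel t y y'`, read as `y' = t + y`, makes the nonempty set `Y` a principal
homogeneous space over the abelian group `T`. -/
structure IsPrincipalHomogeneous {T Y : Type} [AddCommGroup T] (Rel : T → Y → Y → Prop) : Prop where
  nonempty : Nonempty Y
  existsUnique_translate : ∀ t y, ∃! y', Rel t y y'
  zero : ∀ y, Rel 0 y y
  add : ∀ s t y y' y'', Rel s y y' → Rel t y' y'' → Rel (t + s) y y''
  existsUnique_difference : ∀ y y', ∃! t, Rel t y y'

/-- `χ ∈ H²(G, A)` is the class of the extension `S` of the group `G` by the `G`-module `A`: for a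
section `σ`, it is represented by the cocycle `c` with `σ g · σ h = c (g, h) · σ (g h)`. -/
def IsExtensionClass {G : Type} [Group G] (A : Rep.{0} ℤ G) {E : Type} [Group E]
    (S : GroupExtension (Multiplicative A) E G) (χ : groupCohomology.H2 A) : Prop :=
  ∃ (σ : S.Section) (c : groupCohomology.cocycles₂ A),
    (∀ g h : G, σ g * σ h = S.inl (Multiplicative.ofAdd (c (g, h))) * σ (g * h)) ∧
      groupCohomology.H2π A c = χ

/-- The group `G / γ_4 G`, where `G = F / ⟨r⟩` is the quotient of `F` by the normal closure of the
relators `r`. -/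
abbrev NilQuot {n : ℕ} {ι : Type*} (r : ι → F n) : Type :=
  PresentedGroup (Set.range r) ⧸ (⊤ : Subgroup (PresentedGroup (Set.range r))).lowerCentralSeries 3

/-- The quotient map `F → G / γ_4 G`. -/
def toNilQuot {n : ℕ} {ι : Type*} (r : ι → F n) : F n →* NilQuot r :=
  (QuotientGroup.mk' _).comp (PresentedGroup.mk (Set.range r))

section Main

variable {L P : Type*} {n : ℕ} (C : ProjectiveConfiguration L P) (l : Fin (n + 1) ≃ L)

/-- `S` is the extension `1 → γ_2 G / γ_4 G → G / γ_4 G → H → 1`, where the `H`-module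
`γ_2 G / γ_4 G` is identified with `M` by an isomorphism that is compatible with the canonical
isomorphisms of the submodule `γ_3 G / γ_4 G` with `P_3` and of the quotient `γ_2 G / γ_3 G`
with `P_2`. -/
structure IsIdentification {ι : Type*} (r : ι → F n)
    (S : GroupExtension (Multiplicative (M C l)) (NilQuot r) (H n)) : Prop where
  /-- The projection to `H` is the canonical one. -/
  rightHom_eq : ∀ w : F n, S.rightHom (toNilQuot r w) = Abelianization.of w
  /-- The action of `H` on `M` is the one induced by conjugation. -/
  conj_eq : ∀ (e : NilQuot r) (m : M C l), e * S.inl (Multiplicative.ofAdd m) * e⁻¹ =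
    S.inl (Multiplicative.ofAdd ((M C l).ρ (S.rightHom e) m))
  /-- On `P_3`, the identification sends the class of `u ∈ γ_3 F` to the image of `u`. -/
  inl_P3 : ∀ (u : F n) (hu : u ∈ (⊤ : Subgroup (F n)).lowerCentralSeries 2),
    S.inl (Multiplicative.ofAdd ((QuotientAddGroup.mk (Gr.mk u hu), 0) : P3 C l × P2 C l)) =
      toNilQuot r u
  /-- Modulo `γ_3`, an element of `M` over the class in `P_2` of `u ∈ γ_2 F` goes to the image
  of `u`. -/
  inl_P2 : ∀ (u : F n) (hu : u ∈ (⊤ : Subgroup (F n)).lowerCentralSeries 1) (a : P3 C l),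
    (toNilQuot r u)⁻¹ *
      S.inl (Multiplicative.ofAdd ((a, QuotientAddGroup.mk (Gr.mk u hu)) : P3 C l × P2 C l)) ∈
        (⊤ : Subgroup (NilQuot r)).lowerCentralSeries 2

/-- `y ∈ Y` is the invariant `χ̄_3` of the relators `r`: the orbit of the class `χ_3 ∈ H²(H, M)` of
the extension `1 → M → G / γ_4 G → H → 1`. -/
def IsChi3 {ι : Type*} (r : ι → F n) (y : Y C l) : Prop :=
  ∃ (S : GroupExtension (Multiplicative (M C l)) (NilQuot r) (H n)) (χ : Fibre C l),
    IsIdentification C l r S ∧ IsExtensionClass (M C l) S χ.1 ∧ Quotient.mk _ χ = y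

end Main

/-- The isomorphism `e : G / γ_4 G ≃ G' / γ_4 G'` extends the canonical isomorphism
`G / γ_2 G ≃ H ≃ G' / γ_2 G'`: modulo commutators, it sends the image of each `w ∈ F` to the image
of `w`. -/
def ExtendsCanonical {n : ℕ} {ι : Type*} {r r' : ι → F n} (e : NilQuot r ≃* NilQuot r') : Prop :=
  ∀ w : F n, Abelianization.of (e (toNilQuot r w)) = Abelianization.of (toNilQuot r' w)

end LineArrangement

open LineArrangement

/-! The proof has a cohomological half and a group-theoretical half.

For a trivial module `A`, the map `H²(H, A) → Hom(L_2, A)` is bijective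
(`commutatorForm_injective`, `commutatorForm_surjective`). A shear by `f : P_2 → P_3` acts on
`H²(H, M)` as `χ ↦ χ + α (f_* (β χ))` (`shearH2_apply`), so on the fibre over `χ_2` it is
translation by `α` of the class with form `L_2 → P_2 → P_3`, that is, of a class vanishing on `R_2`.
By the long exact sequence, the fibre is a torsor under `H²(H, P_3) / δ Hom(H, P_2)`. Since `R_2` is a direct
summand of `L_2`, dividing by the shears amounts to restricting forms to `R_2`, and `Y` is a torsor
under `T` as soon as it is nonempty (`isPrincipalHomogeneous_of_nonempty`).

The geometry enters through one fact: the `r̄(i, p)` have a dual family of functionals on `L_2`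
(`dualForm_rBar`). If `m` is the least index of a line through `p`, then the coefficient of
`[x_i, x_m]` is `1` in `r̄(i, p)` and `0` in all other relators, because two lines have only one
common point. Hence `R_2` is a direct summand of `L_2` and `P_2` is projective; moreover, modulo
the preimage of `R_3` the normal closure of the relators meets `γ_3 F` trivially, so that `P_3` is
the group `γ_3 G / γ_4 G` (`mk_mem_R3`). Lifting the projective group `P_2` to `γ_2 G / γ_4 G`
identifies this module with `M` (`exists_identification`). Two identifications differ by a shear
(`IsIdentification.exists_shear`), so the class of the extension is a well-defined point of `Y`.

An isomorphism `G / γ_4 G ≃ G' / γ_4 G'` over `H` agrees with the canonical maps on the graded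
pieces, hence carries an identification to an identification with the same class
(`IsChi3.of_mulEquiv`). Conversely, extensions whose classes correspond under a shear are isomorphic over `H`
(`exists_mulEquiv_of_isChi3`). So the isomorphism exists if and only if the two points of the
torsor `Y` coincide, which is to say that their difference vanishes. -/

namespace LineArrangement

/-! ### Graded pieces of the lower central series -/

section GradedPieces

variable {G : Type*} [Group G] {j : ℕ}

theorem Gr.mk_congr {u v : G} (h : u = v) (hu : u ∈ (⊤ : Subgroup G).lowerCentralSeries j)
    (hv : v ∈ (⊤ : Subgroup G).lowerCentralSeries j) : Gr.mk u hu = Gr.mk v hv := by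
  subst h; rfl

theorem Gr.mk_eq_zero_iff {u : G} (hu : u ∈ (⊤ : Subgroup G).lowerCentralSeries j) :
    Gr.mk u hu = 0 ↔ u ∈ (⊤ : Subgroup G).lowerCentralSeries (j + 1) := by
  have h : (0 : Gr G j) = Gr.mk 1 (one_mem _) := rfl
  rw [h, eq_comm, Gr.mk_eq_iff (one_mem _) hu]
  simp

theorem Gr.mk_inv {u : G} (hu : u ∈ (⊤ : Subgroup G).lowerCentralSeries j) :
    Gr.mk u⁻¹ (inv_mem hu) = -Gr.mk u hu := rfl

theorem conj_mem_lcs (x : G) {u : G} (hu : u ∈ (⊤ : Subgroup G).lowerCentralSeries j) :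
    x * u * x⁻¹ ∈ (⊤ : Subgroup G).lowerCentralSeries j :=
  (inferInstance : ((⊤ : Subgroup G).lowerCentralSeries j).Normal).conj_mem u hu x

theorem Gr.mk_conj (x : G) {u : G} (hu : u ∈ (⊤ : Subgroup G).lowerCentralSeries j) :
    Gr.mk (x * u * x⁻¹) (conj_mem_lcs x hu) = Gr.mk u hu := by
  rw [eq_comm, Gr.mk_eq_iff]
  have e : u⁻¹ * (x * u * x⁻¹) = ⁅u⁻¹, x⁆ := by simp [commutatorElement_def, mul_assoc]
  rw [e, ← inv_mem_iff, commutatorElement_inv]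
  exact commutator_mem_lcs x (inv_mem hu)

theorem mem_lcs_one_iff {u : G} :
    u ∈ (⊤ : Subgroup G).lowerCentralSeries 1 ↔ Abelianization.of u = 1 :=
  (QuotientGroup.eq_one_iff u).symm

/-- The class in `gr_2 G` of a commutator depends only on the two classes in the abelianization. -/
theorem Gr.mk_commutator_congr {u u' v v' : G} (hu : Abelianization.of u = Abelianization.of u')
    (hv : Abelianization.of v = Abelianization.of v') :
    Gr.mk ⁅u, v⁆ (commutator_mem_lcs (j := 0) u (Subgroup.mem_top v)) =
      Gr.mk ⁅u', v'⁆ (commutator_mem_lcs (j := 0) u' (Subgroup.mem_top v')) := by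
  have e : Gr.mk (j := 0) v (Subgroup.mem_top v) = Gr.mk (j := 0) v' (Subgroup.mem_top v') := by
    refine (Gr.mk_eq_iff _ _).2 (mem_lcs_one_iff.2 ?_)
    rw [map_mul, map_inv, hv, inv_mul_cancel]
  have h := bracket_mk (j := 0) u (Subgroup.mem_top v)
  have h' := bracket_mk (j := 0) u' (Subgroup.mem_top v')
  rw [← hu, ← e] at h'
  exact h.symm.trans h'

/-- Homomorphisms out of `gr_2 G` are determined by their values on commutators. -/
theorem Gr.hom_ext_commutator {A : Type*} [AddCommGroup A] {φ₁ φ₂ : Gr G 1 →+ A}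
    (h : ∀ u v : G, φ₁ (Gr.mk ⁅u, v⁆ (commutator_mem_lcs u (Subgroup.mem_top v))) =
      φ₂ (Gr.mk ⁅u, v⁆ (commutator_mem_lcs u (Subgroup.mem_top v)))) : φ₁ = φ₂ := by
  refine AddMonoidHom.ext fun x => ?_
  obtain ⟨u, hu, rfl⟩ := Gr.exists_mk x
  refine Subgroup.closure_induction (p := fun x hx => φ₁ (Gr.mk (j := 1) x hx) =
    φ₂ (Gr.mk (j := 1) x hx)) ?_ ?_ ?_ ?_ hu
  · rintro x ⟨p, -, q, -, rfl⟩
    exact h p q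
  · exact (map_zero φ₁).trans (map_zero φ₂).symm
  · intro x y hx hy ihx ihy
    have e := Gr.mk_mul (j := 1) hx hy
    exact ((congrArg φ₁ e).trans (map_add φ₁ _ _)).trans
      ((congrArg₂ (· + ·) ihx ihy).trans ((congrArg φ₂ e).trans (map_add φ₂ _ _)).symm)
  · intro x hx ih
    exact (map_neg φ₁ _).trans ((congrArg Neg.neg ih).trans (map_neg φ₂ _).symm)

end GradedPieces

/-! ### The second cohomology of `H` with trivial coefficients -/

section CommutatorForm

open groupCohomology CategoryTheory

variable {n : ℕ} {A : Type} [AddCommGroup A]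

theorem cocycle_eq (c : cocycles₂ (Rep.trivial ℤ (H n) A)) (x y z : H n) :
    c (x * y, z) + c (x, y) = c (y, z) + c (x, y * z) :=
  (mem_cocycles₂_iff c.1).1 c.2 x y z

/-- A cocycle `c` on `H` with vanishing commutator form is a coboundary: a primitive `f` of its
pullback to `F` descends to `H`. -/
theorem commutatorForm_injective :
    Function.Injective (commutatorForm : H2 (Rep.trivial ℤ (H n) A) →+ (Gr (F n) 1 →+ A)) := by
  rw [injective_iff_map_eq_zero]
  intro ψ hψ
  induction ψ using H2_induction_on with | h c =>
  obtain ⟨f, hf⟩ := exists_primitive c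
  have h1 : ∀ x : H n, c (1, x) = c (1, 1) := cocycles₂_map_one_fst c
  have hcomm : ∀ u v : F n, f ⁅u, v⁆ + c (1, 1) = 0 := by
    intro u v
    have e : ⁅u, v⁆ * (v * u) = u * v := by simp [commutatorElement_def, mul_assoc]
    have := hf ⁅u, v⁆ (v * u)
    have h0 := commutatorForm_H2π c u v
    rw [hψ, AddMonoidHom.zero_apply] at h0
    rw [e, hf u v, hf v u, abelianization_of_eq_one
      (commutator_mem_lcs u (Subgroup.mem_top v)), h1] at this
    rw [h0, ← sub_eq_of_eq_add' this]
    abel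
  have hker : ∀ u : F n, Abelianization.of u = 1 → f u + c (1, 1) = 0 := by
    intro u hu
    rw [← mem_lcs_one_iff] at hu
    let g : ↥((⊤ : Subgroup (F n)).lowerCentralSeries 1) →* Multiplicative A :=
      MonoidHom.mk' (fun u => Multiplicative.ofAdd (f u + c (1, 1))) (fun u v => by
        rw [← ofAdd_add]
        congr 1
        rw [Subgroup.coe_mul, hf, abelianization_of_eq_one u.2, h1]
        abel)
    have key : (⊤ : Subgroup (F n)).lowerCentralSeries 1 ≤
        g.ker.map ((⊤ : Subgroup (F n)).lowerCentralSeries 1).subtype := by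
      refine Subgroup.commutator_le.2 fun u _ v _ =>
        ⟨⟨⁅u, v⁆, commutator_mem_lcs u (Subgroup.mem_top v)⟩, ?_, rfl⟩
      exact congrArg Multiplicative.ofAdd (hcomm u v)
    obtain ⟨w, hw, rfl⟩ := key hu
    exact hw
  have hfac : ∀ u v : F n, Abelianization.of u = Abelianization.of v → f u = f v := by
    intro u v huv
    have hk : Abelianization.of (u * v⁻¹) = (1 : H n) := by
      rw [map_mul, map_inv, huv, mul_inv_cancel]
    have := hf (u * v⁻¹) v
    rw [hk, h1, inv_mul_cancel_right] at this
    rw [this, add_right_comm, hker _ hk, zero_add]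
  have hs : ∀ x : H n, ∃ u : F n, Abelianization.of u = x := QuotientGroup.mk_surjective
  choose σ hσ using hs
  rw [H2π_eq_zero_iff]
  refine ⟨fun x => -f (σ x), funext fun g => ?_⟩
  obtain ⟨x, y⟩ := g
  change -f (σ y) - -f (σ (x * y)) + -f (σ x) = c (x, y)
  rw [hfac (σ (x * y)) (σ x * σ y) (by rw [map_mul, hσ, hσ, hσ]), hf, hσ, hσ]
  abel

/-- Every homomorphism `φ : L_2 → A` is a commutator form: push the extension
`1 → L_2 → F / γ_3 F → H → 1` forward along `φ`. -/
theorem commutatorForm_surjective :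
    Function.Surjective (commutatorForm : H2 (Rep.trivial ℤ (H n) A) →+ (Gr (F n) 1 →+ A)) := by
  intro φ
  have hs : ∀ x : H n, ∃ u : F n, Abelianization.of u = x := QuotientGroup.mk_surjective
  choose σ hσ using hs
  have hk : ∀ x y : H n, σ x * σ y * (σ (x * y))⁻¹ ∈
      (⊤ : Subgroup (F n)).lowerCentralSeries 1 := fun x y => by
    rw [mem_lcs_one_iff, map_mul, map_mul, map_inv, hσ, hσ, hσ, mul_inv_cancel]
  have hc : ∀ x y z : H n, Gr.mk _ (hk (x * y) z) + Gr.mk _ (hk x y) =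
      Gr.mk _ (hk y z) + Gr.mk _ (hk x (y * z)) := by
    intro x y z
    rw [add_comm, ← Gr.mk_mul, ← Gr.mk_conj (σ x) (hk y z), ← Gr.mk_mul]
    refine Gr.mk_congr ?_ _ _
    rw [mul_assoc x y z]
    group
  let c : cocycles₂ (Rep.trivial ℤ (H n) A) :=
    ⟨fun g => φ (Gr.mk _ (hk g.1 g.2)), (mem_cocycles₂_iff _).2 fun x y z => by
      change φ _ + φ _ = φ _ + φ _
      rw [← map_add, ← map_add]
      exact congrArg φ (hc x y z)⟩
  refine ⟨H2π _ c, Gr.hom_ext_commutator fun u v => ?_⟩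
  rw [commutatorForm_H2π]
  change φ (Gr.mk _ (hk _ _)) - φ (Gr.mk _ (hk _ _)) = _
  rw [← map_sub, Gr.mk_commutator_congr (hσ (Abelianization.of u)).symm
    (hσ (Abelianization.of v)).symm, sub_eq_add_neg, ← Gr.mk_inv, ← Gr.mk_mul]
  refine congrArg φ (Gr.mk_congr ?_ _ _)
  rw [mul_comm (Abelianization.of v)]
  simp only [commutatorElement_def]
  group

/-- The morphism of trivial `H`-modules given by a homomorphism of abelian groups. -/
noncomputable def trivialMap {B : Type} [AddCommGroup B] (f : A →+ B) :
    Rep.trivial ℤ (H n) A ⟶ Rep.trivial ℤ (H n) B :=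
  Rep.ofHom (LinearMap.intertwiningMap_of_isIntertwiningMap _ _ f.toIntLinearMap
    (fun _ _ => rfl))

theorem functor_map_H2π {G : Type} [Group G] {A B : Rep.{0} ℤ G} (φ : A ⟶ B)
    {c : cocycles₂ A} {d : cocycles₂ B} (h : ∀ x y : G, d (x, y) = φ.hom (c (x, y))) :
    (groupCohomology.functor ℤ G 2).map φ (H2π A c) = H2π B d := by
  have e : d = mapCocycles₂ (MonoidHom.id G) φ c := cocycles₂_ext h
  rw [e]
  exact H2π_comp_map_apply (MonoidHom.id G) φ c

/-- The homomorphism `H²(H, A) → H²(H, B)` induced by a homomorphism of trivial modules. -/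
noncomputable def pushH2 {B : Type} [AddCommGroup B] (f : A →+ B) :
    H2 (Rep.trivial ℤ (H n) A) →+ H2 (Rep.trivial ℤ (H n) B) :=
  ((groupCohomology.functor ℤ (H n) 2).map (trivialMap f)).hom.toAddMonoidHom

theorem pushH2_H2π {B : Type} [AddCommGroup B] (f : A →+ B)
    {c : cocycles₂ (Rep.trivial ℤ (H n) A)} {d : cocycles₂ (Rep.trivial ℤ (H n) B)}
    (h : ∀ x y : H n, d (x, y) = f (c (x, y))) : pushH2 f (H2π _ c) = H2π _ d :=
  functor_map_H2π (trivialMap f) h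

theorem commutatorForm_pushH2 {B : Type} [AddCommGroup B] (f : A →+ B)
    (ψ : H2 (Rep.trivial ℤ (H n) A)) :
    commutatorForm (pushH2 f ψ) =
      f.comp (commutatorForm ψ) := by
  induction ψ using H2_induction_on with | h c =>
  let d : cocycles₂ (Rep.trivial ℤ (H n) B) := ⟨fun g => f (c g), (mem_cocycles₂_iff _).2
    fun x y z => (map_add f _ _).symm.trans
      ((congrArg f (cocycle_eq c x y z)).trans (map_add f _ _))⟩
  rw [pushH2_H2π f (d := d) fun _ _ => rfl]
  refine Gr.hom_ext_commutator fun u v => ?_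
  rw [AddMonoidHom.comp_apply, commutatorForm_H2π, commutatorForm_H2π, map_sub]
  rfl

end CommutatorForm

/-! ### The abelian group `L_2` -/

section FreeGroup

open groupCohomology CategoryTheory

variable {n : ℕ}

/-- The class `[x_a, x_b]` in `L_2`. -/
def basicCommutator (a b : Fin n) : Gr (F n) 1 :=
  Gr.mk ⁅FreeGroup.of a, FreeGroup.of b⁆ (commutator_mem_lcs _ (Subgroup.mem_top _))

theorem basicCommutator_self (a : Fin n) : basicCommutator a a = 0 :=
  (Gr.mk_eq_zero_iff _).2 (by rw [commutatorElement_self]; exact one_mem _)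

theorem basicCommutator_swap (a b : Fin n) : basicCommutator b a = -basicCommutator a b := by
  unfold basicCommutator
  rw [← Gr.mk_inv]
  exact Gr.mk_congr (commutatorElement_inv _ _).symm _ _

/-- Homomorphisms out of `L_2` are determined by their values on the `[x_a, x_b]`. -/
theorem hom_ext_basicCommutator {A : Type*} [AddCommGroup A] {φ₁ φ₂ : Gr (F n) 1 →+ A}
    (h : ∀ a b, φ₁ (basicCommutator a b) = φ₂ (basicCommutator a b)) : φ₁ = φ₂ := by
  let right (φ : Gr (F n) 1 →+ A) (u : F n) : F n →* Multiplicative A :=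
    MonoidHom.mk' (fun v => Multiplicative.ofAdd
      (φ (Gr.mk ⁅u, v⁆ (commutator_mem_lcs u (Subgroup.mem_top v)))))
      (fun v w => (congrArg (fun z => Multiplicative.ofAdd (φ z)) (Gr.mk_commutator_mul_right
        (j := 0) u (Subgroup.mem_top v) (Subgroup.mem_top w))).trans
          (congrArg Multiplicative.ofAdd (map_add φ _ _)))
  let left (φ : Gr (F n) 1 →+ A) (v : F n) : F n →* Multiplicative A :=
    MonoidHom.mk' (fun u => Multiplicative.ofAdd
      (φ (Gr.mk ⁅u, v⁆ (commutator_mem_lcs u (Subgroup.mem_top v)))))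
      (fun u w => (congrArg (fun z => Multiplicative.ofAdd (φ z)) (Gr.mk_commutator_mul_left
        (j := 0) u w (Subgroup.mem_top v))).trans
          (congrArg Multiplicative.ofAdd (map_add φ _ _)))
  have h1 : ∀ b, left φ₁ (FreeGroup.of b) = left φ₂ (FreeGroup.of b) := fun b =>
    FreeGroup.ext_hom _ _ fun a => congrArg Multiplicative.ofAdd (h a b)
  have h2 : ∀ u, right φ₁ u = right φ₂ u := fun u =>
    FreeGroup.ext_hom _ _ fun b => DFunLike.congr_fun (h1 b) u
  exact Gr.hom_ext_commutator fun u v => congrArg Multiplicative.toAdd (DFunLike.congr_fun (h2 u) v)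

/-- The `i`-th coordinate on `H`. -/
def coordH (i : Fin n) : Additive (H n) →+ ℤ :=
  MonoidHom.toAdditiveLeft (Abelianization.lift
    (FreeGroup.lift fun j => Multiplicative.ofAdd (if j = i then 1 else 0)))

theorem coordH_of (i j : Fin n) :
    coordH i (Additive.ofMul (Abelianization.of (FreeGroup.of j))) = if j = i then 1 else 0 := by
  simp [coordH]

/-- The homomorphism `L_2 → ℤ` with `[x, y] ↦ x_i y_m - y_i x_m`, the commutator form of the
bilinear cocycle `(x, y) ↦ x_i y_m`. -/
noncomputable def pairForm (i m : Fin n) : Gr (F n) 1 →+ ℤ :=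
  commutatorForm (H2π (Rep.trivial ℤ (H n) ℤ) ⟨fun g =>
    coordH i (Additive.ofMul g.1) * coordH m (Additive.ofMul g.2), (mem_cocycles₂_iff _).2
      fun x y z => by
        change coordH i (Additive.ofMul (x * y)) * coordH m (Additive.ofMul z) +
            coordH i (Additive.ofMul x) * coordH m (Additive.ofMul y) =
          coordH i (Additive.ofMul y) * coordH m (Additive.ofMul z) +
            coordH i (Additive.ofMul x) * coordH m (Additive.ofMul (y * z))
        rw [ofMul_mul, ofMul_mul, map_add, map_add]
        ring⟩)

theorem pairForm_basicCommutator (i m a b : Fin n) :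
    pairForm i m (basicCommutator a b) =
      (if a = i then 1 else 0) * (if b = m then 1 else 0) -
        (if b = i then 1 else 0) * (if a = m then 1 else 0) := by
  unfold pairForm basicCommutator
  rw [commutatorForm_H2π]
  change coordH i _ * coordH m _ - coordH i _ * coordH m _ = _
  simp only [coordH_of]

/-- The `[x_a, x_b]` with `a < b` and the forms `pairForm a b` are dual bases of `L_2`. -/
theorem sum_pairForm_smul (x : Gr (F n) 1) :
    ∑ p : {p : Fin n × Fin n // p.1 < p.2},
      pairForm p.1.1 p.1.2 x • basicCommutator p.1.1 p.1.2 = x := by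
  let φ : Gr (F n) 1 →+ Gr (F n) 1 := (∑ p : {p : Fin n × Fin n // p.1 < p.2},
    LinearMap.smulRight (pairForm p.1.1 p.1.2).toIntLinearMap
      (basicCommutator p.1.1 p.1.2)).toAddMonoidHom
  have hφ : ∀ x, φ x = ∑ p : {p : Fin n × Fin n // p.1 < p.2},
      pairForm p.1.1 p.1.2 x • basicCommutator p.1.1 p.1.2 := fun x => by simp [φ]
  rw [← hφ]
  refine DFunLike.congr_fun (?_ : φ = AddMonoidHom.id _) x
  have key : ∀ a b, a < b → φ (basicCommutator a b) = basicCommutator a b := fun a b hab => by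
    rw [hφ, Finset.sum_eq_single ⟨(a, b), hab⟩]
    · rw [pairForm_basicCommutator]
      simp [hab.ne, hab.ne']
    · rintro ⟨⟨c, d⟩, hcd⟩ - hne
      rw [pairForm_basicCommutator]
      have h1 : ¬ (a = c ∧ b = d) := fun h => hne (by simp [h.1, h.2])
      have h2 : ¬ (b = c ∧ a = d) := fun h => by
        obtain ⟨rfl, rfl⟩ := h
        exact lt_asymm hab hcd
      rw [ite_zero_mul_ite_zero, ite_zero_mul_ite_zero, if_neg h1, if_neg h2, sub_zero, zero_smul]
    · simp
  refine hom_ext_basicCommutator fun a b => ?_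
  rw [AddMonoidHom.id_apply]
  rcases lt_trichotomy a b with h | rfl | h
  · exact key a b h
  · rw [basicCommutator_self, map_zero]
  · rw [basicCommutator_swap, map_neg, key b a h]

/-- `L_2` is a free abelian group on the `[x_a, x_b]` with `a < b`; only its projectivity is
needed. -/
instance projective_L2 : Module.Projective ℤ (Gr (F n) 1) :=
  Module.Projective.of_split (M := {p : Fin n × Fin n // p.1 < p.2} → ℤ)
    (LinearMap.pi fun p => (pairForm p.1.1 p.1.2).toIntLinearMap)
    (Fintype.linearCombination ℤ fun p => basicCommutator p.1.1 p.1.2)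
    (LinearMap.ext fun x => sum_pairForm_smul x)

end FreeGroup

/-! ### The relators in `L_2` -/

section Relators

variable {L P : Type*} {n : ℕ} (C : ProjectiveConfiguration L P) (l : Fin (n + 1) ≃ L)

theorem exists_isLeast (s : RelatorIndex C l) :
    ∃ m : Fin n, IsLeast {j : Fin n | C.Inc (l j.succ) s.1.2} m :=
  ⟨_, WellFounded.min_mem wellFounded_lt _ ⟨s.1.1, s.2.2.1⟩,
    fun _ h => not_lt.1 (WellFounded.not_lt_min wellFounded_lt _ h)⟩

/-- The least index of a line through the point of `s`. -/
noncomputable def leastLine (s : RelatorIndex C l) : Fin n := (exists_isLeast C l s).choose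

theorem isLeast_leastLine (s : RelatorIndex C l) :
    IsLeast {j : Fin n | C.Inc (l j.succ) s.1.2} (leastLine C l s) :=
  (exists_isLeast C l s).choose_spec

theorem fst_ne_leastLine (s : RelatorIndex C l) : s.1.1 ≠ leastLine C l s := fun h =>
  s.2.2.2 (h ▸ isLeast_leastLine C l s)

theorem point_unique {i j : Fin n} (hij : i ≠ j) {p q : P} (hip : C.Inc (l i.succ) p)
    (hjp : C.Inc (l j.succ) p) (hiq : C.Inc (l i.succ) q) (hjq : C.Inc (l j.succ) q) : p = q :=
  (C.existsUnique_point _ _ fun h => hij (Fin.succ_injective _ (l.injective h))).unique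
    ⟨hip, hjp⟩ ⟨hiq, hjq⟩

instance finite_relatorIndex : Finite (RelatorIndex C l) := by
  refine Finite.of_injective (fun s => (s.1.1, leastLine C l s)) fun s t h => ?_
  obtain ⟨h1, h2⟩ := Prod.mk.inj h
  refine Subtype.ext (Prod.ext h1 (point_unique C l (fst_ne_leastLine C l s) s.2.2.1
    (isLeast_leastLine C l s).1 ?_ ?_))
  · rw [h1]; exact t.2.2.1
  · rw [h2]; exact (isLeast_leastLine C l t).1

open Classical in
theorem rBar_eq_sum (s : RelatorIndex C l) :
    rBar C l s = ∑ j : Fin n with C.Inc (l j.succ) s.1.2, basicCommutator s.1.1 j := by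
  rw [rBar, map_sum]
  rfl

/-- The functional on `L_2` dual to the relator `r̄(i, p)`: it reads off the coefficient of
`[x_i, x_m]`, where `m` is the least index of a line through `p`. -/
noncomputable def dualForm (s : RelatorIndex C l) : Gr (F n) 1 →+ ℤ :=
  pairForm s.1.1 (leastLine C l s)

open Classical in
/-- The `r̄(i, p)` are linearly independent and span a direct summand of `L_2`. Two lines meet in
one point only, so `[x_i, x_m]` occurs in no relator other than `r̄(i, p)`. -/
theorem dualForm_rBar (s t : RelatorIndex C l) :
    dualForm C l s (rBar C l t) = if s = t then 1 else 0 := by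
  have hm := (isLeast_leastLine C l s).1
  have hne := fst_ne_leastLine C l s
  have e : dualForm C l s (rBar C l t) =
      (if t.1.1 = s.1.1 ∧ C.Inc (l (leastLine C l s).succ) t.1.2 then 1 else 0) -
        (if C.Inc (l s.1.1.succ) t.1.2 ∧ t.1.1 = leastLine C l s then 1 else 0) := by
    rw [rBar_eq_sum, map_sum]
    simp only [dualForm, pairForm_basicCommutator]
    rw [Finset.sum_sub_distrib, ← Finset.mul_sum, ← Finset.sum_mul, Finset.sum_ite_eq',
      Finset.sum_ite_eq', ite_zero_mul_ite_zero, ite_zero_mul_ite_zero]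
    simp
  rw [e]
  by_cases h : s = t
  · subst h
    rw [if_pos ⟨rfl, hm⟩, if_neg fun h => hne h.2, if_pos rfl, sub_zero]
  · rw [if_neg h, if_neg, if_neg, sub_zero]
    · rintro ⟨h1, h2⟩
      have hp := point_unique C l hne s.2.2.1 hm h1 (h2 ▸ t.2.2.1)
      refine t.2.2.2 ?_
      rw [h2, ← hp]
      exact isLeast_leastLine C l s
    · rintro ⟨h1, h2⟩
      exact h (Subtype.ext (Prod.ext h1.symm
        (point_unique C l hne s.2.2.1 hm (h1 ▸ t.2.2.1) h2)))

theorem rBar_mem_R2 (s : RelatorIndex C l) : rBar C l s ∈ R2 C l :=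
  AddSubgroup.subset_closure ⟨s, rfl⟩

open Classical in
/-- `R_2` is a direct summand of `L_2`. -/
theorem exists_retraction :
    ∃ ρ : Gr (F n) 1 →+ R2 C l, ∀ x : R2 C l, ρ x = x := by
  have := Fintype.ofFinite (RelatorIndex C l)
  let ρ : Gr (F n) 1 →+ R2 C l := (∑ s : RelatorIndex C l, LinearMap.smulRight
    (dualForm C l s).toIntLinearMap (⟨rBar C l s, rBar_mem_R2 C l s⟩ : R2 C l)).toAddMonoidHom
  have hρ : ∀ x, ρ x = ∑ s : RelatorIndex C l,
      dualForm C l s x • (⟨rBar C l s, rBar_mem_R2 C l s⟩ : R2 C l) := fun x => by simp [ρ]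
  have key : ∀ x ∈ R2 C l, (ρ x : Gr (F n) 1) = x := by
    intro x hx
    induction hx using AddSubgroup.closure_induction with
    | mem x hx =>
      obtain ⟨t, rfl⟩ := hx
      rw [hρ, Finset.sum_eq_single t]
      · simp [dualForm_rBar]
      · intro s _ hs
        rw [dualForm_rBar, if_neg hs, zero_smul]
      · simp
    | zero => rw [map_zero]; rfl
    | add x y _ _ hx hy => rw [map_add, AddSubgroup.coe_add, hx, hy]
    | neg x _ hx => rw [map_neg, AddSubgroup.coe_neg, hx]
  exact ⟨ρ, fun x => Subtype.ext (key x x.2)⟩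

instance projective_P2 : Module.Projective ℤ (P2 C l) := by
  obtain ⟨ρ, hρ⟩ := exists_retraction C l
  let i : P2 C l →+ Gr (F n) 1 := QuotientAddGroup.lift (R2 C l)
    (AddMonoidHom.id _ - (R2 C l).subtype.comp ρ) fun x hx => by
      have := congrArg Subtype.val (hρ ⟨x, hx⟩)
      exact sub_eq_zero.2 this.symm
  refine Module.Projective.of_split i.toIntLinearMap
    (QuotientAddGroup.mk' (R2 C l)).toIntLinearMap (LinearMap.ext fun b => ?_)
  induction b using QuotientAddGroup.induction_on with | H x =>
  change (QuotientAddGroup.mk (x - (ρ x : Gr (F n) 1)) : P2 C l) = QuotientAddGroup.mk x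
  rw [QuotientAddGroup.eq]
  simp

end Relators

/-! ### The action of `T` on `Y` -/

section Torsor

open groupCohomology CategoryTheory

variable {L P : Type*} {n : ℕ} (C : ProjectiveConfiguration L P) (l : Fin (n + 1) ≃ L)

theorem beta_alpha (ψ : H2 (repP3 C l)) : beta C l (alpha C l ψ) = 0 := by
  have h := (mapShortComplex₂ (seqM C l) 2).moduleCat_zero_apply ψ
  exact h

theorem exists_alpha_eq {χ : H2 (M C l)} (h : beta C l χ = 0) : ∃ ψ, alpha C l ψ = χ :=
  (ShortComplex.moduleCat_exact_iff _).1 (mapShortComplex₂_exact (seqM_shortExact C l) 2) χ h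

theorem alpha_delta (g : Additive (H n) →+ P2 C l) : alpha C l (delta C l g) = 0 :=
  (mapShortComplex₁ (seqM_shortExact C l) (i := 1) (j := 2) rfl).moduleCat_zero_apply _

theorem exists_delta_eq {ψ : H2 (repP3 C l)} (h : alpha C l ψ = 0) :
    ∃ g : Additive (H n) →+ P2 C l, delta C l g = ψ := by
  obtain ⟨x, hx⟩ : ∃ x : H1 (repP2 C l), groupCohomology.δ (seqM_shortExact C l) 1 2 rfl x = ψ :=
    (ShortComplex.moduleCat_exact_iff _).1
      (mapShortComplex₁_exact (seqM_shortExact C l) (i := 1) (j := 2) rfl) ψ h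
  refine ⟨(H1IsoOfIsTrivial (repP2 C l)).hom x, Eq.trans ?_ hx⟩
  change groupCohomology.δ (seqM_shortExact C l) 1 2 rfl
    ((H1IsoOfIsTrivial (repP2 C l)).inv ((H1IsoOfIsTrivial (repP2 C l)).hom x)) = _
  rw [Iso.hom_inv_id_apply]

/-- The shear by `f` differs from the identity on `H²(H, M)` by `α ∘ f_* ∘ β`. -/
theorem shearH2_apply (f : P2 C l →+ P3 C l) (χ : H2 (M C l)) :
    shearH2 C l f χ = χ +
      alpha C l (pushH2 f (beta C l χ)) := by
  induction χ using H2_induction_on with | h c =>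
  let c₂ := mapCocycles₂ (MonoidHom.id (H n)) (projM C l) c
  let c₃ := mapCocycles₂ (MonoidHom.id (H n)) (trivialMap f) c₂
  let c₄ := mapCocycles₂ (MonoidHom.id (H n)) (inclM C l) c₃
  have h₂ : beta C l (H2π _ c) = H2π _ c₂ := functor_map_H2π (projM C l) fun _ _ => rfl
  have h₃ : pushH2 f (H2π _ c₂) = H2π _ c₃ :=
    pushH2_H2π f fun _ _ => rfl
  have h₄ : alpha C l (H2π _ c₃) = H2π _ c₄ := functor_map_H2π (inclM C l) fun _ _ => rfl
  rw [h₂, h₃, h₄, ← map_add]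
  refine functor_map_H2π (shear C l f) fun x y => ?_
  exact Prod.ext rfl (add_zero (Prod.snd (α := P3 C l) (β := P2 C l) (c (x, y))))

theorem shearH2_alpha (f : P2 C l →+ P3 C l) (ψ : H2 (repP3 C l)) :
    shearH2 C l f (alpha C l ψ) = alpha C l ψ := by
  rw [shearH2_apply, beta_alpha, map_zero, map_zero, add_zero]

/-- On the fibre over `χ_2`, the class `f_* (β χ)` depends on `f` only: its form is
`L_2 → P_2 → P_3`. -/
theorem commutatorForm_pushH2_beta (f : P2 C l →+ P3 C l) (χ : Fibre C l) :
    commutatorForm (pushH2 f (beta C l χ.1)) =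
      f.comp (QuotientAddGroup.mk' (R2 C l)) := by
  rw [commutatorForm_pushH2, χ.2]

/-- Translation of a fibre element by a class of `H²(H, P_3)` that restricts to zero in `T` does
not change its orbit. -/
theorem equiv_add_alpha (χ : Fibre C l) {ψ : H2 (repP3 C l)}
    (h : formOnR2 C l ψ ∈ (deltaBar C l).range) :
    ∃ f, shearH2 C l f χ.1 = χ.1 + alpha C l ψ := by
  obtain ⟨g, hg⟩ := h
  have h0 : formOnR2 C l (ψ - delta C l g) = 0 := by
    rw [map_sub, ← hg]
    exact sub_self _
  -- the commutator form of `ψ - δ g` vanishes on `R_2`, so it is pulled back from `P_2`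
  let f : P2 C l →+ P3 C l := QuotientAddGroup.lift (R2 C l)
    (commutatorForm (ψ - delta C l g)) fun x hx => by
      have := DFunLike.congr_fun h0 ⟨x, hx⟩
      exact this
  refine ⟨f, ?_⟩
  have hf : pushH2 f (beta C l χ.1) =
      ψ - delta C l g := by
    apply commutatorForm_injective
    rw [commutatorForm_pushH2_beta]
    rfl
  rw [shearH2_apply, hf, map_sub, alpha_delta, sub_zero]

/-- If translation by a class of `H²(H, P_3)` stays in the orbit, the class is zero in `T`. -/
theorem mem_range_of_alpha_eq (χ : Fibre C l) (f : P2 C l →+ P3 C l) {ψ : H2 (repP3 C l)}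
    (h : shearH2 C l f χ.1 = χ.1 + alpha C l ψ) : formOnR2 C l ψ ∈ (deltaBar C l).range := by
  rw [shearH2_apply, add_right_inj, ← sub_eq_zero, ← map_sub] at h
  obtain ⟨g, hg⟩ := exists_delta_eq C l h
  refine neg_mem_iff.1 ⟨g, ?_⟩
  have h0 : formOnR2 C l (pushH2 f
      (beta C l χ.1)) = 0 := by
    refine AddMonoidHom.ext fun x => ?_
    change commutatorForm (pushH2 f
      (beta C l χ.1)) x = 0
    rw [commutatorForm_pushH2_beta]
    exact (congrArg f ((QuotientAddGroup.eq_zero_iff _).2 x.2)).trans (map_zero f)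
  have h1 : deltaBar C l g = formOnR2 C l (delta C l g) := rfl
  rw [h1, hg, map_sub, h0]
  exact zero_sub (formOnR2 C l ψ)

/-- Forms on `R_2` extend to `L_2`, as `R_2` is a direct summand. -/
theorem formOnR2_surjective : Function.Surjective (formOnR2 C l) := by
  intro τ
  obtain ⟨ρ, hρ⟩ := exists_retraction C l
  obtain ⟨ψ, hψ⟩ := commutatorForm_surjective (τ.comp ρ)
  refine ⟨ψ, AddMonoidHom.ext fun x => ?_⟩
  change commutatorForm ψ x = τ x
  rw [hψ, AddMonoidHom.comp_apply, hρ]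

/-- The translate of a fibre element by a class of `H²(H, P_3)`. -/
noncomputable def Fibre.translate (χ : Fibre C l) (ψ : H2 (repP3 C l)) : Fibre C l :=
  ⟨χ.1 + alpha C l ψ, by rw [map_add, beta_alpha, add_zero, χ.2]⟩

theorem Fibre.coe_translate (χ : Fibre C l) (ψ : H2 (repP3 C l)) :
    (Fibre.translate C l χ ψ).1 = χ.1 + alpha C l ψ := rfl

/-- A translate can be computed with any representative of the first point. -/
theorem isTranslate_iff (t : T C l) (χ : Fibre C l) (y' : Y C l) :
    IsTranslate C l t (Quotient.mk _ χ) y' ↔ ∃ ψ, t = QuotientAddGroup.mk (formOnR2 C l ψ) ∧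
      y' = Quotient.mk _ (Fibre.translate C l χ ψ) := by
  constructor
  · rintro ⟨χ₁, χ₁', ψ, h1, rfl, h3, rfl⟩
    obtain ⟨f, hf⟩ := Quotient.exact h1
    refine ⟨ψ, rfl, Quotient.sound ⟨f, ?_⟩⟩
    rw [h3, map_add, hf, shearH2_alpha]
    rfl
  · rintro ⟨ψ, rfl, rfl⟩
    exact ⟨χ, _, ψ, rfl, rfl, rfl, rfl⟩

theorem mk_translate_eq_iff (χ : Fibre C l) (ψ ψ' : H2 (repP3 C l)) :
    (Quotient.mk _ (Fibre.translate C l χ ψ) : Y C l) = Quotient.mk _ (Fibre.translate C l χ ψ') ↔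
      (QuotientAddGroup.mk (formOnR2 C l ψ) : T C l) = QuotientAddGroup.mk (formOnR2 C l ψ') := by
  have e : ∀ f, shearH2 C l f (χ.1 + alpha C l ψ) = χ.1 + alpha C l ψ' ↔
      shearH2 C l f χ.1 = χ.1 + alpha C l (-ψ + ψ') := fun f => by
    rw [map_add, shearH2_alpha, map_add, map_neg, ← add_assoc, add_right_comm, ← sub_eq_add_neg,
      eq_sub_iff_add_eq]
  rw [QuotientAddGroup.eq, ← map_neg, ← map_add]
  constructor
  · intro h
    obtain ⟨f, hf⟩ := Quotient.exact h
    exact mem_range_of_alpha_eq C l χ f ((e f).1 hf)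
  · intro h
    obtain ⟨f, hf⟩ := equiv_add_alpha C l χ h
    exact Quotient.sound ⟨f, (e f).2 hf⟩

/-- Two points of the fibre have the same image under `β`, as a class of `H²(H, P_2)` is determined
by its form; hence they differ by an element of the image of `α`. -/
theorem exists_translate_eq (χ χ' : Fibre C l) : ∃ ψ, χ' = Fibre.translate C l χ ψ := by
  have h : beta C l (χ'.1 - χ.1) = 0 := by
    rw [map_sub, sub_eq_zero]
    exact commutatorForm_injective (χ'.2.trans χ.2.symm)
  obtain ⟨ψ, hψ⟩ := exists_alpha_eq C l h
  exact ⟨ψ, Subtype.ext (by rw [Fibre.coe_translate, hψ, add_sub_cancel])⟩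

theorem isPrincipalHomogeneous_of_nonempty (hY : Nonempty (Y C l)) :
    IsPrincipalHomogeneous (IsTranslate C l) where
  nonempty := hY
  existsUnique_translate t y := by
    obtain ⟨χ, rfl⟩ := Quotient.exists_rep y
    obtain ⟨τ, rfl⟩ := QuotientAddGroup.mk_surjective t
    obtain ⟨ψ, rfl⟩ := formOnR2_surjective C l τ
    refine ⟨_, (isTranslate_iff C l _ χ _).2 ⟨ψ, rfl, rfl⟩, fun y' hy' => ?_⟩
    obtain ⟨ψ', h, rfl⟩ := (isTranslate_iff C l _ χ _).1 hy'
    exact (mk_translate_eq_iff C l χ ψ' ψ).2 h.symm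
  zero y := by
    obtain ⟨χ, rfl⟩ := Quotient.exists_rep y
    refine (isTranslate_iff C l _ χ _).2 ⟨0, ?_, congrArg _ (Subtype.ext ?_)⟩
    · rw [map_zero]; rfl
    · rw [Fibre.coe_translate, map_zero, add_zero]
  add s t y y' y'' h h' := by
    obtain ⟨χ, rfl⟩ := Quotient.exists_rep y
    obtain ⟨ψ, rfl, rfl⟩ := (isTranslate_iff C l _ χ _).1 h
    obtain ⟨ψ', rfl, rfl⟩ := (isTranslate_iff C l _ _ _).1 h'
    refine (isTranslate_iff C l _ χ _).2 ⟨ψ' + ψ, ?_, congrArg _ (Subtype.ext ?_)⟩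
    · rw [map_add]; rfl
    · simp only [Fibre.translate, map_add]
      rw [add_assoc, add_comm (alpha C l ψ)]
  existsUnique_difference y y' := by
    obtain ⟨χ, rfl⟩ := Quotient.exists_rep y
    obtain ⟨χ', rfl⟩ := Quotient.exists_rep y'
    obtain ⟨ψ, rfl⟩ := exists_translate_eq C l χ χ'
    refine ⟨_, (isTranslate_iff C l _ χ _).2 ⟨ψ, rfl, rfl⟩, fun t ht => ?_⟩
    obtain ⟨ψ', rfl, h⟩ := (isTranslate_iff C l _ χ _).1 ht
    exact (mk_translate_eq_iff C l χ ψ' ψ).1 h.symm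

end Torsor

/-! ### Classes of group extensions -/

section Extensions

open groupCohomology CategoryTheory

variable {G : Type} [Group G] {A B : Rep.{0} ℤ G} {E E' : Type} [Group E] [Group E']

/-- Conjugation in the extension `S` induces the given action of `G` on `A`. -/
def ActsByConj (A : Rep.{0} ℤ G) (S : GroupExtension (Multiplicative A) E G) : Prop :=
  ∀ (e : E) (m : A), e * S.inl (Multiplicative.ofAdd m) * e⁻¹ =
    S.inl (Multiplicative.ofAdd (A.ρ (S.rightHom e) m))

theorem ActsByConj.mul_inl {S : GroupExtension (Multiplicative A) E G} (hS : ActsByConj A S)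
    (e : E) (m : A) : e * S.inl (Multiplicative.ofAdd m) =
      S.inl (Multiplicative.ofAdd (A.ρ (S.rightHom e) m)) * e := by
  rw [← hS, inv_mul_cancel_right]

theorem inl_add (S : GroupExtension (Multiplicative A) E G) (a b : A) :
    S.inl (Multiplicative.ofAdd (a + b)) =
      S.inl (Multiplicative.ofAdd a) * S.inl (Multiplicative.ofAdd b) := by
  rw [ofAdd_add, map_mul]

theorem inl_ofAdd_injective (S : GroupExtension (Multiplicative A) E G) :
    Function.Injective fun a : A => S.inl (Multiplicative.ofAdd a) :=
  S.inl_injective.comp Multiplicative.ofAdd.injective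

theorem exists_inl_mul (S : GroupExtension (Multiplicative A) E G) {x y : E}
    (h : S.rightHom x = S.rightHom y) : ∃ a : A, x = S.inl (Multiplicative.ofAdd a) * y := by
  have hm : x * y⁻¹ ∈ S.inl.range := by
    rw [S.range_inl_eq_ker_rightHom, MonoidHom.mem_ker, map_mul, map_inv, h, mul_inv_cancel]
  obtain ⟨a, ha⟩ := hm
  exact ⟨a.toAdd, by rw [ofAdd_toAdd, ha, inv_mul_cancel_right]⟩

/-- Every section of an extension has a factor set, which is a cocycle. -/
theorem exists_factorSet {S : GroupExtension (Multiplicative A) E G} (hS : ActsByConj A S)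
    (σ : S.Section) : ∃ c : cocycles₂ A, ∀ g h : G,
      σ g * σ h = S.inl (Multiplicative.ofAdd (c (g, h))) * σ (g * h) := by
  have hc : ∀ p : G × G, ∃ a : A,
      σ p.1 * σ p.2 = S.inl (Multiplicative.ofAdd a) * σ (p.1 * p.2) := fun p =>
    exists_inl_mul S (by simp)
  choose c hc using hc
  refine ⟨⟨c, (mem_cocycles₂_iff c).2 fun g h j => ?_⟩, fun g h => hc (g, h)⟩
  apply inl_ofAdd_injective S
  apply mul_right_cancel (b := σ (g * h * j))
  simp only [inl_add]
  have e1 := hc (g, h)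
  have e2 := hc (g * h, j)
  have e3 := hc (h, j)
  have e4 := hc (g, h * j)
  simp only at e1 e2 e3 e4
  have e5 := hS.mul_inl (σ g) (c (h, j))
  rw [GroupExtension.Section.rightHom_section] at e5
  calc _ = S.inl (Multiplicative.ofAdd (c (g, h))) *
        (S.inl (Multiplicative.ofAdd (c (g * h, j))) * σ (g * h * j)) := by
        rw [← mul_assoc, ← inl_add, ← inl_add, add_comm]
    _ = σ g * (σ h * σ j) := by rw [← e2, ← mul_assoc, ← e1, mul_assoc]
    _ = _ := by rw [e3, ← mul_assoc, e5, mul_assoc, e4, mul_assoc g, ← mul_assoc]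

/-- A morphism of extensions over `φ : A → B` maps the class of the source to the class of the
target. -/
theorem IsExtensionClass.map {S : GroupExtension (Multiplicative A) E G}
    {S' : GroupExtension (Multiplicative B) E' G} (φ : A ⟶ B) (e : E →* E')
    (hinl : ∀ a : A, e (S.inl (Multiplicative.ofAdd a)) =
      S'.inl (Multiplicative.ofAdd (φ.hom a)))
    (hright : ∀ x, S'.rightHom (e x) = S.rightHom x) {χ : H2 A} (h : IsExtensionClass A S χ) :
    IsExtensionClass B S' ((groupCohomology.functor ℤ G 2).map φ χ) := by
  obtain ⟨σ, c, hσ, rfl⟩ := h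
  refine ⟨⟨fun g => e (σ g), fun g => by rw [hright, GroupExtension.Section.rightHom_section]⟩,
    mapCocycles₂ (MonoidHom.id G) φ c, fun g h => ?_, ?_⟩
  · change e (σ g) * e (σ h) = S'.inl (Multiplicative.ofAdd (φ.hom (c (g, h)))) * e (σ (g * h))
    rw [← hinl, ← map_mul e, ← map_mul e, hσ]
  · exact (functor_map_H2π φ fun _ _ => rfl).symm

/-- Changing a section by a cochain `k` changes its factor set by the coboundary of `k`. -/
theorem factorSet_smul {S : GroupExtension (Multiplicative A) E G} (hS : ActsByConj A S)
    (σ : S.Section) {c : G × G → A}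
    (hσ : ∀ g h : G, σ g * σ h = S.inl (Multiplicative.ofAdd (c (g, h))) * σ (g * h))
    (k : G → A) (g h : G) :
    S.inl (Multiplicative.ofAdd (k g)) * σ g * (S.inl (Multiplicative.ofAdd (k h)) * σ h) =
      S.inl (Multiplicative.ofAdd (c (g, h) + (A.ρ g (k h) - k (g * h) + k g))) *
        (S.inl (Multiplicative.ofAdd (k (g * h))) * σ (g * h)) := by
  have e5 := hS.mul_inl (σ g) (k h)
  rw [GroupExtension.Section.rightHom_section] at e5
  rw [mul_assoc, ← mul_assoc (σ g), e5, mul_assoc, hσ, ← mul_assoc, ← mul_assoc, ← inl_add,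
    ← inl_add, ← mul_assoc, ← inl_add]
  congr 3
  abel

/-- The class of an extension does not depend on the section. -/
theorem IsExtensionClass.unique {S : GroupExtension (Multiplicative A) E G} (hS : ActsByConj A S)
    {χ χ' : H2 A} (h : IsExtensionClass A S χ) (h' : IsExtensionClass A S χ') : χ = χ' := by
  obtain ⟨σ, c, hσ, rfl⟩ := h
  obtain ⟨σ', c', hσ', rfl⟩ := h'
  have hk : ∀ g, ∃ a : A, σ g = S.inl (Multiplicative.ofAdd a) * σ' g := fun g =>
    exists_inl_mul S (by simp)
  choose k hk using hk
  rw [H2π_eq_iff]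
  refine ⟨k, funext fun p => ?_⟩
  obtain ⟨g, h⟩ := p
  change A.ρ g (k h) - k (g * h) + k g = c (g, h) - c' (g, h)
  rw [eq_sub_iff_add_eq']
  apply inl_ofAdd_injective S
  apply mul_right_cancel (b := σ (g * h))
  simp only
  rw [← hσ, hk, hk, hk, factorSet_smul hS σ' hσ']

/-- Extensions whose classes correspond under an isomorphism of the kernels are isomorphic. -/
theorem exists_mulEquiv_of_class {S : GroupExtension (Multiplicative A) E G}
    {S' : GroupExtension (Multiplicative B) E' G} (hS : ActsByConj A S) (hS' : ActsByConj B S')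
    (φ : A ⟶ B) (hφ : Function.Bijective φ.hom) {χ : H2 A} (h : IsExtensionClass A S χ)
    (h' : IsExtensionClass B S' ((groupCohomology.functor ℤ G 2).map φ χ)) :
    ∃ e : E ≃* E', ∀ x, S'.rightHom (e x) = S.rightHom x := by
  obtain ⟨σ, c, hσ, rfl⟩ := h
  obtain ⟨σ', c', hσ', hcc⟩ := h'
  rw [functor_map_H2π φ (d := mapCocycles₂ (MonoidHom.id G) φ c) fun _ _ => rfl, eq_comm,
    H2π_eq_iff] at hcc
  obtain ⟨k, hk⟩ := hcc
  have hk' : ∀ g h : G, c' (g, h) + (B.ρ g (k h) - k (g * h) + k g) = φ.hom (c (g, h)) :=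
    fun g h => by
      rw [← eq_sub_iff_add_eq']
      exact congrFun hk (g, h)
  -- the section `τ` of `S'` has factor set `φ ∘ c`
  let τ : G → E' := fun g => S'.inl (Multiplicative.ofAdd (k g)) * σ' g
  have hτ : ∀ g h, τ g * τ h = S'.inl (Multiplicative.ofAdd (φ.hom (c (g, h)))) * τ (g * h) :=
    fun g h => by rw [← hk']; exact factorSet_smul hS' σ' hσ' k g h
  have hτr : ∀ g, S'.rightHom (τ g) = g := fun g => by simp [τ]
  clear_value τ
  have hx : ∀ x : E, ∃ a : A, x = S.inl (Multiplicative.ofAdd a) * σ (S.rightHom x) := fun x =>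
    exists_inl_mul S (by simp)
  choose a ha using hx
  have ha' : ∀ (b : A) (g : G), a (S.inl (Multiplicative.ofAdd b) * σ g) = b := fun b g => by
    apply inl_ofAdd_injective S
    apply mul_right_cancel (b := σ g)
    have := ha (S.inl (Multiplicative.ofAdd b) * σ g)
    rw [map_mul, S.rightHom_inl, one_mul, GroupExtension.Section.rightHom_section] at this
    exact this.symm
  have hmul : ∀ x y, a (x * y) =
      a x + (A.ρ (S.rightHom x) (a y) + c (S.rightHom x, S.rightHom y)) := fun x y => by
    rw [← ha' (a x + (A.ρ (S.rightHom x) (a y) + c (S.rightHom x, S.rightHom y)))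
      (S.rightHom x * S.rightHom y)]
    congr 1
    conv_lhs => rw [ha x, ha y]
    have e5 := hS.mul_inl (σ (S.rightHom x)) (a y)
    rw [GroupExtension.Section.rightHom_section] at e5
    rw [mul_assoc, ← mul_assoc (σ _), e5, mul_assoc, hσ, inl_add, inl_add, mul_assoc, mul_assoc]
  let e : E →* E' := MonoidHom.mk'
    (fun x => S'.inl (Multiplicative.ofAdd (φ.hom (a x))) * τ (S.rightHom x)) fun x y => by
      have e5 := hS'.mul_inl (τ (S.rightHom x)) (φ.hom (a y))
      rw [hτr] at e5
      have e6 : φ.hom (A.ρ (S.rightHom x) (a y)) = B.ρ (S.rightHom x) (φ.hom (a y)) :=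
        Rep.hom_comm_apply φ _ _
      rw [hmul, map_add φ.hom, map_add φ.hom, e6, map_mul S.rightHom, inl_add, inl_add,
        mul_assoc, mul_assoc, ← hτ, mul_assoc, ← mul_assoc (τ _), e5, mul_assoc]
  have he : ∀ x, e x = S'.inl (Multiplicative.ofAdd (φ.hom (a x))) * τ (S.rightHom x) :=
    fun _ => rfl
  have her : ∀ x, S'.rightHom (e x) = S.rightHom x := fun x => by
    rw [he, map_mul, S'.rightHom_inl, one_mul, hτr]
  have hbij : Function.Bijective e := by
    constructor
    · intro x y hxy
      have hr : S.rightHom x = S.rightHom y := by rw [← her, hxy, her]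
      rw [he, he, hr] at hxy
      have := hφ.1 (inl_ofAdd_injective S' (mul_right_cancel hxy))
      rw [ha x, ha y, this, hr]
    · intro y
      obtain ⟨b, hb⟩ := exists_inl_mul S' (hτr (S'.rightHom y)).symm
      obtain ⟨d, rfl⟩ := hφ.2 b
      refine ⟨S.inl (Multiplicative.ofAdd d) * σ (S'.rightHom y), ?_⟩
      rw [he, ha', map_mul, S.rightHom_inl, one_mul, GroupExtension.Section.rightHom_section]
      exact hb.symm
  exact ⟨MulEquiv.ofBijective e hbij, her⟩

end Extensions

/-! ### Functoriality of the graded pieces -/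

section GradedMaps

variable {G G' : Type*} [Group G] [Group G']

theorem map_mem_lcs (f : G →* G') {j : ℕ} {u : G}
    (hu : u ∈ (⊤ : Subgroup G).lowerCentralSeries j) :
    f u ∈ (⊤ : Subgroup G').lowerCentralSeries j := by
  have h : f u ∈ ((⊤ : Subgroup G).lowerCentralSeries j).map f := ⟨u, hu, rfl⟩
  rw [Subgroup.map_lowerCentralSeries] at h
  exact Subgroup.lowerCentralSeries_mono j le_top h

theorem exists_mem_lcs_of_surjective {f : G →* G'} (hf : Function.Surjective f) {j : ℕ} {x : G'}
    (hx : x ∈ (⊤ : Subgroup G').lowerCentralSeries j) :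
    ∃ u ∈ (⊤ : Subgroup G).lowerCentralSeries j, f u = x := by
  rw [← Subgroup.map_top_of_surjective f hf, ← Subgroup.map_lowerCentralSeries] at hx
  exact hx

/-- The homomorphism of graded pieces induced by a group homomorphism. -/
def Gr.map (f : G →* G') (j : ℕ) : Gr G j →+ Gr G' j :=
  MonoidHom.toAdditive <| QuotientGroup.lift _
    (MonoidHom.mk' (fun u : ↥((⊤ : Subgroup G).lowerCentralSeries j) =>
      (Gr.mk (f (u : G)) (map_mem_lcs f u.2)).toMul)
      (fun u v => congrArg Additive.toMul ((Gr.mk_congr (map_mul f (u : G) v) _ _).trans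
        (Gr.mk_mul (map_mem_lcs f u.2) (map_mem_lcs f v.2)))))
    (fun _ hu => congrArg Additive.toMul ((Gr.mk_eq_zero_iff _).2
      (map_mem_lcs f (Subgroup.mem_subgroupOf.1 hu))))

theorem Gr.map_mk (f : G →* G') {j : ℕ} {u : G}
    (hu : u ∈ (⊤ : Subgroup G).lowerCentralSeries j) :
    Gr.map f j (Gr.mk u hu) = Gr.mk (f u) (map_mem_lcs f hu) := rfl

/-- Homomorphisms that agree modulo `γ_2` agree on `γ_{j+1}` modulo `γ_{j+2}`. -/
theorem inv_mul_mem_lcs_of_congr {f g : G →* G'}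
    (h : ∀ w, (f w)⁻¹ * g w ∈ (⊤ : Subgroup G').lowerCentralSeries 1) (j : ℕ) {u : G}
    (hu : u ∈ (⊤ : Subgroup G).lowerCentralSeries j) :
    (f u)⁻¹ * g u ∈ (⊤ : Subgroup G').lowerCentralSeries (j + 1) := by
  induction j generalizing u with
  | zero => exact h u
  | succ j ih =>
    let N := (⊤ : Subgroup G').lowerCentralSeries (j + 1 + 1)
    have key : (⊤ : Subgroup G).lowerCentralSeries (j + 1) ≤
        ((QuotientGroup.mk' N).comp f).eqLocus ((QuotientGroup.mk' N).comp g) := by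
      refine Subgroup.commutator_le.2 fun v hv w _ => ?_
      rw [← commutatorElement_inv, inv_mem_iff]
      refine QuotientGroup.eq.2 ?_
      have hab : Abelianization.of (f w) = Abelianization.of (g w) := by
        have := mem_lcs_one_iff.1 (h w)
        rwa [map_mul, map_inv, inv_mul_eq_one] at this
      have hv' : Gr.mk (f v) (map_mem_lcs f hv) = Gr.mk (g v) (map_mem_lcs g hv) :=
        (Gr.mk_eq_iff _ _).2 (ih hv)
      have e := bracket_mk (f w) (map_mem_lcs f hv)
      rw [hab, hv', bracket_mk] at e
      rw [map_commutatorElement, map_commutatorElement]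
      exact (Gr.mk_eq_iff _ _).1 e.symm
    exact QuotientGroup.eq.1 (key hu)

end GradedMaps

/-! ### The graded pieces of `G / γ_4 G` -/

section NilQuot

variable {L P : Type*} {n : ℕ} (C : ProjectiveConfiguration L P) (l : Fin (n + 1) ≃ L)

theorem toNilQuot_surjective {ι : Type*} (r : ι → F n) : Function.Surjective (toNilQuot r) :=
  (QuotientGroup.mk'_surjective _).comp (PresentedGroup.mk_surjective _)

theorem lcs_three_nilQuot {ι : Type*} (r : ι → F n) :
    (⊤ : Subgroup (NilQuot r)).lowerCentralSeries 3 = ⊥ := by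
  rw [eq_bot_iff]
  intro x hx
  obtain ⟨u, hu, rfl⟩ := exists_mem_lcs_of_surjective (QuotientGroup.mk'_surjective _) hx
  exact (QuotientGroup.eq_one_iff u).2 hu

theorem toNilQuot_relator {ι : Type*} (r : ι → F n) (s : ι) : toNilQuot r (r s) = 1 := by
  rw [toNilQuot, MonoidHom.comp_apply, PresentedGroup.one_of_mem (Set.mem_range_self s), map_one]

/-- The kernel of `F → G / γ_4 G` is the product of the normal closure of the relators and
`γ_4 F`. -/
theorem exists_of_toNilQuot_eq_one {ι : Type*} {r : ι → F n} {u : F n} (h : toNilQuot r u = 1) :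
    ∃ g ∈ (⊤ : Subgroup (F n)).lowerCentralSeries 3,
      u * g⁻¹ ∈ Subgroup.normalClosure (Set.range r) := by
  obtain ⟨g, hg, hgu⟩ := exists_mem_lcs_of_surjective (PresentedGroup.mk_surjective (Set.range r))
    ((QuotientGroup.eq_one_iff _).1 h)
  refine ⟨g, hg, PresentedGroup.mk_eq_one_iff.1 ?_⟩
  rw [map_mul, map_inv, hgu, mul_inv_cancel]

/-- Elements of `γ_3 (G / γ_4 G)` are central. -/
theorem commute_of_mem_lcs_two {ι : Type*} {r : ι → F n} {z : NilQuot r}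
    (hz : z ∈ (⊤ : Subgroup (NilQuot r)).lowerCentralSeries 2) (x : NilQuot r) : Commute x z := by
  have h := commutator_mem_lcs x hz
  rw [lcs_three_nilQuot, Subgroup.mem_bot] at h
  exact commutatorElement_eq_one_iff_commute.1 h

variable {C l} {r : RelatorIndex C l → F n}

theorem map_toNilQuot_R2 (hr : IsAdmissible C l r) {x : Gr (F n) 1} (hx : x ∈ R2 C l) :
    Gr.map (toNilQuot r) 1 x = 0 := by
  have h : R2 C l ≤ (Gr.map (toNilQuot r) 1).ker := by
    refine (AddSubgroup.closure_le _).2 ?_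
    rintro _ ⟨s, rfl⟩
    obtain ⟨hs, e⟩ := hr s
    change Gr.map (toNilQuot r) 1 (rBar C l s) = 0
    rw [← e, Gr.map_mk, Gr.mk_eq_zero_iff, toNilQuot_relator]
    exact one_mem _
  exact h hx

theorem map_toNilQuot_R3 (hr : IsAdmissible C l r) {x : Gr (F n) 2} (hx : x ∈ R3 C l) :
    Gr.map (toNilQuot r) 2 x = 0 := by
  have h : R3 C l ≤ (Gr.map (toNilQuot r) 2).ker := by
    refine (AddSubgroup.closure_le _).2 ?_
    rintro _ ⟨h, x, hx, rfl⟩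
    change Gr.map (toNilQuot r) 2 _ = 0
    have hq := map_toNilQuot_R2 hr hx
    obtain ⟨w, rfl⟩ : ∃ w : F n, Additive.ofMul (Abelianization.of w) = h :=
      QuotientGroup.mk_surjective h.toMul
    obtain ⟨u, hu, rfl⟩ := Gr.exists_mk x
    rw [Gr.map_mk, Gr.mk_eq_zero_iff] at hq
    rw [bracket_mk, Gr.map_mk, Gr.mk_eq_zero_iff, map_commutatorElement]
    exact commutator_mem_lcs _ hq
  exact h hx

/-- The elements of `γ_2 F` whose class in `L_2` lies in `R_2`. -/
def preimageR2 (C : ProjectiveConfiguration L P) (l : Fin (n + 1) ≃ L) : Subgroup (F n) where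
  carrier := {u | ∃ hu, Gr.mk (j := 1) u hu ∈ R2 C l}
  one_mem' := ⟨one_mem _, zero_mem _⟩
  mul_mem' := fun ⟨hu, h⟩ ⟨hv, h'⟩ => ⟨mul_mem hu hv, add_mem h h'⟩
  inv_mem' := fun ⟨hu, h⟩ => ⟨inv_mem hu, neg_mem h⟩

instance : (preimageR2 C l).Normal where
  conj_mem := fun u ⟨hu, h⟩ x => ⟨conj_mem_lcs x hu, by rwa [Gr.mk_conj]⟩

/-- The elements of `γ_3 F` whose class in `L_3` lies in `R_3`. -/
def preimageR3 (C : ProjectiveConfiguration L P) (l : Fin (n + 1) ≃ L) : Subgroup (F n) where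
  carrier := {u | ∃ hu, Gr.mk (j := 2) u hu ∈ R3 C l}
  one_mem' := ⟨one_mem _, zero_mem _⟩
  mul_mem' := fun ⟨hu, h⟩ ⟨hv, h'⟩ => ⟨mul_mem hu hv, add_mem h h'⟩
  inv_mem' := fun ⟨hu, h⟩ => ⟨inv_mem hu, neg_mem h⟩

instance : (preimageR3 C l).Normal where
  conj_mem := fun u ⟨hu, h⟩ x => ⟨conj_mem_lcs x hu, by rwa [Gr.mk_conj]⟩

theorem toNilQuot_ker_le (hr : IsAdmissible C l r) {u : F n} (h : toNilQuot r u = 1) :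
    u ∈ preimageR2 C l := by
  obtain ⟨g, hg, hug⟩ := exists_of_toNilQuot_eq_one h
  have h1 : Subgroup.normalClosure (Set.range r) ≤ preimageR2 C l := by
    refine Subgroup.normalClosure_le_normal ?_
    rintro _ ⟨s, rfl⟩
    obtain ⟨hs, e⟩ := hr s
    exact ⟨hs, e ▸ rBar_mem_R2 C l s⟩
  have hg2 := Subgroup.lowerCentralSeries_antitone _ (by decide : 2 ≤ 3) hg
  have hg1 := Subgroup.lowerCentralSeries_antitone _ (by decide : 1 ≤ 3) hg
  have h2 : g ∈ preimageR2 C l := ⟨hg1, by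
    rw [(Gr.mk_eq_zero_iff hg1).2 hg2]; exact zero_mem _⟩
  simpa using mul_mem (h1 hug) h2

/-- `γ_2 G / γ_3 G` is `P_2`: an element of `γ_2 F` that dies in it has its class in `R_2`. -/
theorem mk_mem_R2 (hr : IsAdmissible C l r) {u : F n}
    (hu : u ∈ (⊤ : Subgroup (F n)).lowerCentralSeries 1)
    (h : toNilQuot r u ∈ (⊤ : Subgroup (NilQuot r)).lowerCentralSeries 2) :
    Gr.mk u hu ∈ R2 C l := by
  obtain ⟨w, hw, e⟩ := exists_mem_lcs_of_surjective (toNilQuot_surjective r) h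
  have hw1 := Subgroup.lowerCentralSeries_antitone _ (by decide : 1 ≤ 2) hw
  obtain ⟨h1, h2⟩ := toNilQuot_ker_le hr (u := u * w⁻¹)
    (by rw [map_mul, map_inv, e, mul_inv_cancel])
  have h3 : Gr.mk (u * w⁻¹) h1 = Gr.mk u hu + -Gr.mk w hw1 := rfl
  rwa [h3, (Gr.mk_eq_zero_iff hw1).2 hw, neg_zero, add_zero] at h2

open Classical in
open scoped IsMulCommutative in
/-- `γ_3 G / γ_4 G` is `P_3`: an element of `γ_3 F` that dies in it has its class in `R_3`.
Modulo the preimage of `R_3` the relators are central, so their normal closure is the abelian group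
they generate; as the `r̄(i, p)` are linearly independent in `L_2`, only its trivial element lies in
`γ_3 F`. -/
theorem mk_mem_R3 (hr : IsAdmissible C l r) {u : F n}
    (hu : u ∈ (⊤ : Subgroup (F n)).lowerCentralSeries 2) (h : toNilQuot r u = 1) :
    Gr.mk u hu ∈ R3 C l := by
  have := Fintype.ofFinite (RelatorIndex C l)
  have hz : ∀ s, (QuotientGroup.mk (r s) : F n ⧸ preimageR3 C l) ∈
      Subgroup.center (F n ⧸ preimageR3 C l) := by
    intro s
    rw [Subgroup.mem_center_iff]
    intro x
    obtain ⟨w, rfl⟩ := QuotientGroup.mk_surjective x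
    obtain ⟨hs, e⟩ := hr s
    have hc : ⁅w, r s⁆ ∈ preimageR3 C l := ⟨commutator_mem_lcs w hs, AddSubgroup.subset_closure
      ⟨Additive.ofMul (Abelianization.of w), rBar C l s, rBar_mem_R2 C l s, by
        rw [← e, bracket_mk]⟩⟩
    have hc' : ⁅(QuotientGroup.mk w : F n ⧸ preimageR3 C l),
        (QuotientGroup.mk (r s) : F n ⧸ preimageR3 C l)⁆ = 1 :=
      (QuotientGroup.eq_one_iff ⁅w, r s⁆).2 hc
    exact commutatorElement_eq_one_iff_mul_comm.1 hc'
  -- `J` sends `r̄(i, p)` to the relator `r(i, p)` modulo the preimage of `R_3`; the elements `u` of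
  -- `γ_2 F` equal to `J` of their class form a normal subgroup `K` containing all relators
  let J : Gr (F n) 1 →+ Additive (Subgroup.center (F n ⧸ preimageR3 C l)) :=
    (∑ s : RelatorIndex C l,
    LinearMap.smulRight (dualForm C l s).toIntLinearMap
      (Additive.ofMul
        (⟨QuotientGroup.mk (r s), hz s⟩ : Subgroup.center (F n ⧸ preimageR3 C l)))).toAddMonoidHom
  have hJ : ∀ s, J (rBar C l s) = Additive.ofMul ⟨QuotientGroup.mk (r s), hz s⟩ := by
    intro s
    simp only [J, LinearMap.toAddMonoidHom_coe, LinearMap.sum_apply, LinearMap.smulRight_apply,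
      AddMonoidHom.coe_toIntLinearMap]
    rw [Finset.sum_eq_single s]
    · rw [dualForm_rBar, if_pos rfl, one_smul]
    · intro t _ ht
      rw [dualForm_rBar, if_neg ht, zero_smul]
    · simp
  let K : Subgroup (F n) :=
    { carrier := {u | ∃ hu, (QuotientGroup.mk u : F n ⧸ preimageR3 C l) =
        (J (Gr.mk (j := 1) u hu)).toMul.1}
      one_mem' := ⟨one_mem _, by
        have e : Gr.mk (1 : F n) (one_mem ((⊤ : Subgroup (F n)).lowerCentralSeries 1)) = 0 := rfl
        rw [e, map_zero]
        rfl⟩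
      mul_mem' := fun {u v} ⟨hu, h⟩ ⟨hv, h'⟩ => ⟨mul_mem hu hv, by
        rw [Gr.mk_mul hu hv, map_add, QuotientGroup.mk_mul, h, h']
        rfl⟩
      inv_mem' := fun {u} ⟨hu, h⟩ => ⟨inv_mem hu, by
        rw [Gr.mk_inv hu, map_neg, QuotientGroup.mk_inv, h]
        rfl⟩ }
  have hKn : K.Normal := ⟨fun u ⟨hu, h⟩ x => ⟨conj_mem_lcs x hu, by
    have hcomm := Subgroup.mem_center_iff.1 (J (Gr.mk u hu)).toMul.2 (QuotientGroup.mk x)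
    rw [Gr.mk_conj, QuotientGroup.mk_mul, QuotientGroup.mk_mul, h, hcomm, QuotientGroup.mk_inv,
      mul_inv_cancel_right]⟩⟩
  obtain ⟨g, hg, hug⟩ := exists_of_toNilQuot_eq_one h
  have h1 : Subgroup.normalClosure (Set.range r) ≤ K := by
    refine Subgroup.normalClosure_le_normal ?_
    rintro _ ⟨s, rfl⟩
    obtain ⟨hs, e⟩ := hr s
    exact ⟨hs, by rw [e, hJ]; rfl⟩
  have hg2 := Subgroup.lowerCentralSeries_antitone _ (by decide : 2 ≤ 3) hg
  obtain ⟨h2, h3⟩ := h1 hug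
  rw [(Gr.mk_eq_zero_iff h2).2 (mul_mem hu (inv_mem hg2)), map_zero] at h3
  obtain ⟨h4, h5⟩ : u * g⁻¹ ∈ preimageR3 C l := (QuotientGroup.eq_one_iff _).1 h3
  have h6 : Gr.mk (u * g⁻¹) h4 = Gr.mk u hu + -Gr.mk g hg2 := rfl
  rwa [h6, (Gr.mk_eq_zero_iff hg2).2 hg, neg_zero, add_zero] at h5

end NilQuot

/-! ### The extension of `H` by `M` -/

section Identification

open CategoryTheory groupCohomology

variable {L P : Type*} {n : ℕ} {C : ProjectiveConfiguration L P} {l : Fin (n + 1) ≃ L}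

section

variable {ι : Type*} (r : ι → F n)

/-- `γ_2 G / γ_4 G` is abelian, as `[γ_2 G, γ_2 G] ⊆ γ_4 G`. -/
instance isMulCommutative_lcs_one :
    IsMulCommutative ↥((⊤ : Subgroup (NilQuot r)).lowerCentralSeries 1) := by
  have h3 : ⁅(⊤ : Subgroup (NilQuot r)).lowerCentralSeries 2, (⊤ : Subgroup (NilQuot r))⁆ = ⊥ :=
    lcs_three_nilQuot r
  have h : ⁅(⊤ : Subgroup (NilQuot r)).lowerCentralSeries 1,
      (⊤ : Subgroup (NilQuot r)).lowerCentralSeries 1⁆ = ⊥ := by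
    refine Subgroup.commutator_commutator_eq_bot_of_rotate ?_ ?_
    · exact (congrArg (⁅·, ⊤⁆) (Subgroup.commutator_comm _ _)).trans h3
    · exact h3
  refine ⟨⟨fun a b => Subtype.ext ?_⟩⟩
  have hab := Subgroup.commutator_mem_commutator a.2 b.2
  rw [h, Subgroup.mem_bot] at hab
  exact commutatorElement_eq_one_iff_mul_comm.1 hab

end

variable {r : RelatorIndex C l → F n}

/-- The group `γ_2 G / γ_4 G`, in additive notation. -/
abbrev Gamma (r : RelatorIndex C l → F n) : Type :=
  Additive ↥((⊤ : Subgroup (NilQuot r)).lowerCentralSeries 1)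

theorem lcs_two_le_lcs_one {G : Type*} [Group G] :
    (⊤ : Subgroup G).lowerCentralSeries 2 ≤ (⊤ : Subgroup G).lowerCentralSeries 1 :=
  Subgroup.lowerCentralSeries_antitone _ (by decide)

open scoped IsMulCommutative in
/-- The canonical homomorphism `P_3 → γ_2 G / γ_4 G` induced by `F → G`. -/
theorem exists_hom_P3 (hr : IsAdmissible C l r) : ∃ ι : P3 C l →+ Gamma r,
    ∀ (u : F n) (hu : u ∈ (⊤ : Subgroup (F n)).lowerCentralSeries 2),
      ((ι (QuotientAddGroup.mk (Gr.mk u hu))).toMul : NilQuot r) = toNilQuot r u := by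
  let κ : Gr (F n) 2 →+ Gamma r := MonoidHom.toAdditive <| QuotientGroup.lift _
    (MonoidHom.mk' (fun u : ↥((⊤ : Subgroup (F n)).lowerCentralSeries 2) =>
      (⟨toNilQuot r (u : F n), map_mem_lcs _ (lcs_two_le_lcs_one u.2)⟩ :
        ↥((⊤ : Subgroup (NilQuot r)).lowerCentralSeries 1)))
      (fun u v => Subtype.ext (map_mul (toNilQuot r) (u : F n) v)))
    (fun u hu => Subtype.ext (by
      have h := map_mem_lcs (toNilQuot r) (Subgroup.mem_subgroupOf.1 hu)
      rw [lcs_three_nilQuot] at h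
      exact h))
  refine ⟨QuotientAddGroup.lift (R3 C l) κ fun x hx => ?_, fun u hu => rfl⟩
  obtain ⟨u, hu, rfl⟩ := Gr.exists_mk x
  have h := map_toNilQuot_R3 hr hx
  rw [Gr.map_mk, Gr.mk_eq_zero_iff, lcs_three_nilQuot] at h
  exact congrArg Additive.ofMul (Subtype.ext h)

open scoped IsMulCommutative in
/-- As `P_2` is projective, `P_2 ≅ γ_2 G / γ_3 G` lifts to a homomorphism `P_2 → γ_2 G / γ_4 G`. -/
theorem exists_hom_P2 (hr : IsAdmissible C l r) : ∃ s : P2 C l →+ Gamma r,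
    ∀ (u : F n) (hu : u ∈ (⊤ : Subgroup (F n)).lowerCentralSeries 1),
      (toNilQuot r u)⁻¹ * ((s (QuotientAddGroup.mk (Gr.mk u hu))).toMul : NilQuot r) ∈
        (⊤ : Subgroup (NilQuot r)).lowerCentralSeries 2 := by
  let π : Gamma r →+ Gr (NilQuot r) 1 := MonoidHom.toAdditive (QuotientGroup.mk' _)
  let θ : P2 C l →+ Gr (NilQuot r) 1 := QuotientAddGroup.lift (R2 C l)
    (Gr.map (toNilQuot r) 1) fun x hx => map_toNilQuot_R2 hr hx
  have hπ : Function.Surjective π := fun x => by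
    obtain ⟨u, hu, rfl⟩ := Gr.exists_mk x
    exact ⟨Additive.ofMul ⟨u, hu⟩, rfl⟩
  obtain ⟨s, hs⟩ := Module.projective_lifting_property π.toIntLinearMap θ.toIntLinearMap
    hπ
  refine ⟨s.toAddMonoidHom, fun u hu => ?_⟩
  have e := LinearMap.congr_fun hs (QuotientAddGroup.mk (Gr.mk u hu))
  exact (Gr.mk_eq_iff (map_mem_lcs _ hu)
    (s (QuotientAddGroup.mk (Gr.mk u hu))).toMul.2).1 e.symm

theorem abelianization_eq_one_of_toNilQuot_eq_one (hr : IsAdmissible C l r) {w : F n}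
    (h : toNilQuot r w = 1) : (Abelianization.of w : H n) = 1 :=
  mem_lcs_one_iff.1 (toNilQuot_ker_le hr h).1

open scoped IsMulCommutative in
/-- The extension `1 → M → G / γ_4 G → H → 1` exists. -/
theorem exists_identification (hr : IsAdmissible C l r) :
    ∃ S : GroupExtension (Multiplicative (M C l)) (NilQuot r) (H n), IsIdentification C l r S := by
  obtain ⟨ι, hι⟩ := exists_hom_P3 hr
  obtain ⟨s, hs⟩ := exists_hom_P2 hr
  let j : P3 C l × P2 C l →+ Gamma r := AddMonoidHom.coprod ι s
  let inl : Multiplicative (P3 C l × P2 C l) →* NilQuot r :=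
    (Subgroup.subtype _).comp (AddMonoidHom.toMultiplicativeLeft j)
  have hinl : ∀ a b, inl (Multiplicative.ofAdd (a, b)) =
      ((ι a).toMul : NilQuot r) * ((s b).toMul : NilQuot r) := fun _ _ => rfl
  have hι0 : ((ι 0).toMul : NilQuot r) = 1 := by rw [map_zero]; rfl
  have hs0 : ((s 0).toMul : NilQuot r) = 1 := by rw [map_zero]; rfl
  have hι2 : ∀ a, ((ι a).toMul : NilQuot r) ∈
      (⊤ : Subgroup (NilQuot r)).lowerCentralSeries 2 := fun a => by
    induction a using QuotientAddGroup.induction_on with | H x =>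
    obtain ⟨u, hu, rfl⟩ := Gr.exists_mk x
    rw [hι]
    exact map_mem_lcs _ hu
  have hinl2 : ∀ (u : F n) (hu : u ∈ (⊤ : Subgroup (F n)).lowerCentralSeries 1) (a : P3 C l),
      (toNilQuot r u)⁻¹ * inl (Multiplicative.ofAdd (a, QuotientAddGroup.mk (Gr.mk u hu))) ∈
        (⊤ : Subgroup (NilQuot r)).lowerCentralSeries 2 := fun u hu a => by
    rw [hinl, (commute_of_mem_lcs_two (hι2 a) _).symm.eq, ← mul_assoc]
    exact mul_mem (hs u hu) (hι2 a)
  have hinj : Function.Injective inl := by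
    rw [injective_iff_map_eq_one]
    intro m hm
    obtain ⟨a, b⟩ := m
    change inl (Multiplicative.ofAdd (a, b)) = 1 at hm
    induction a using QuotientAddGroup.induction_on with | H x =>
    induction b using QuotientAddGroup.induction_on with | H y =>
    obtain ⟨u, hu, rfl⟩ := Gr.exists_mk x
    obtain ⟨v, hv, rfl⟩ := Gr.exists_mk y
    have h2 := hinl2 v hv (QuotientAddGroup.mk (Gr.mk u hu))
    rw [hm, mul_one, inv_mem_iff] at h2
    have hb : (QuotientAddGroup.mk (Gr.mk v hv) : P2 C l) = 0 :=
      (QuotientAddGroup.eq_zero_iff _).2 (mk_mem_R2 hr hv h2)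
    rw [hb, hinl, hs0, mul_one, hι] at hm
    have ha : (QuotientAddGroup.mk (Gr.mk u hu) : P3 C l) = 0 :=
      (QuotientAddGroup.eq_zero_iff _).2 (mk_mem_R3 hr hu hm)
    exact congrArg Multiplicative.ofAdd (Prod.ext ha hb)
  let p : NilQuot r →* H n := MonoidHom.liftOfSurjective (toNilQuot r) (toNilQuot_surjective r)
    ⟨Abelianization.of, fun _ h => abelianization_eq_one_of_toNilQuot_eq_one hr h⟩
  have hp : ∀ w, p (toNilQuot r w) = Abelianization.of w := fun w =>
    MonoidHom.liftOfRightInverse_comp_apply _ _ _ _ w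
  have hrange : inl.range = p.ker := by
    refine le_antisymm ?_ ?_
    · rintro _ ⟨m, rfl⟩
      obtain ⟨u, hu, e⟩ := exists_mem_lcs_of_surjective (toNilQuot_surjective r)
        (AddMonoidHom.toMultiplicativeLeft j m).2
      rw [MonoidHom.mem_ker]
      change p (AddMonoidHom.toMultiplicativeLeft j m : NilQuot r) = 1
      rw [← e, hp, abelianization_of_eq_one hu]
    · intro x hx
      obtain ⟨u, rfl⟩ := toNilQuot_surjective r x
      rw [MonoidHom.mem_ker, hp, ← mem_lcs_one_iff] at hx
      obtain ⟨v, hv, e⟩ := exists_mem_lcs_of_surjective (toNilQuot_surjective r) (hinl2 u hx 0)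
      refine ⟨Multiplicative.ofAdd (-QuotientAddGroup.mk (Gr.mk v hv),
        QuotientAddGroup.mk (Gr.mk u hx)), ?_⟩
      rw [hinl, hι0, one_mul] at e
      rw [hinl, map_neg]
      change ((ι (QuotientAddGroup.mk (Gr.mk v hv))).toMul : NilQuot r)⁻¹ * _ = _
      have hc := (commute_of_mem_lcs_two (map_mem_lcs (toNilQuot r) hv) (toNilQuot r u)).eq
      rw [hι, inv_mul_eq_iff_eq_mul, ← hc, e, mul_inv_cancel_left]
  refine ⟨⟨inl, p, hinj, hrange, fun x => ?_⟩, hp, fun e m => ?_, fun u hu => ?_, hinl2⟩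
  · obtain ⟨w, rfl⟩ := QuotientGroup.mk_surjective x
    exact ⟨toNilQuot r w, hp w⟩
  · obtain ⟨a, b⟩ : P3 C l × P2 C l := m
    obtain ⟨w, rfl⟩ := toNilQuot_surjective r e
    induction b using QuotientAddGroup.induction_on with | H y =>
    obtain ⟨v, hv, rfl⟩ := Gr.exists_mk y
    change toNilQuot r w * inl (Multiplicative.ofAdd (a, QuotientAddGroup.mk (Gr.mk v hv))) *
      (toNilQuot r w)⁻¹ = inl (Multiplicative.ofAdd (a + bracketP C l
        (Additive.ofMul (p (toNilQuot r w))) (QuotientAddGroup.mk (Gr.mk v hv)),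
          QuotientAddGroup.mk (Gr.mk v hv)))
    have hb : bracketP C l (Additive.ofMul (Abelianization.of w))
        (QuotientAddGroup.mk (Gr.mk v hv)) =
          QuotientAddGroup.mk (Gr.mk ⁅w, v⁆ (commutator_mem_lcs w hv)) := rfl
    rw [hp, hb, hinl, hinl, map_add]
    change _ = ((ι a).toMul : NilQuot r) * ((ι (QuotientAddGroup.mk _)).toMul : NilQuot r) * _
    rw [hι, map_commutatorElement]
    obtain ⟨z, hz, e⟩ : ∃ z ∈ (⊤ : Subgroup (NilQuot r)).lowerCentralSeries 2,
        ((s (QuotientAddGroup.mk (Gr.mk v hv))).toMul : NilQuot r) = toNilQuot r v * z :=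
      ⟨_, hs v hv, by simp⟩
    have h1 := (commute_of_mem_lcs_two (hι2 a) (toNilQuot r w)).eq
    have h2 := (commute_of_mem_lcs_two hz (toNilQuot r w)⁻¹).eq
    rw [e, ← mul_assoc (toNilQuot r w), h1, commutatorElement_def]
    simp only [mul_assoc]
    rw [← h2]
    simp
  · change inl (Multiplicative.ofAdd (QuotientAddGroup.mk (Gr.mk u hu), 0)) = _
    rw [hinl, hs0, hι, mul_one]

end Identification

/-! ### The invariant `χ̄_3` -/

section Invariant

open CategoryTheory groupCohomology

variable {L P : Type*} {n : ℕ} {C : ProjectiveConfiguration L P} {l : Fin (n + 1) ≃ L}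
  {r r' : RelatorIndex C l → F n} {S : GroupExtension (Multiplicative (M C l)) (NilQuot r) (H n)}

theorem IsIdentification.actsByConj (hS : IsIdentification C l r S) : ActsByConj (M C l) S :=
  hS.conj_eq

/-- The component in `P_2` of an element of `M` can be read off in `G / γ_4 G` modulo `γ_3`. -/
theorem IsIdentification.snd_eq (hS : IsIdentification C l r S) (hr : IsAdmissible C l r)
    {u : F n} (hu : u ∈ (⊤ : Subgroup (F n)).lowerCentralSeries 1) {m : P3 C l × P2 C l}
    (h : (toNilQuot r u)⁻¹ * S.inl (Multiplicative.ofAdd m) ∈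
      (⊤ : Subgroup (NilQuot r)).lowerCentralSeries 2) :
    m.2 = QuotientAddGroup.mk (Gr.mk u hu) := by
  obtain ⟨a, b⟩ := m
  induction b using QuotientAddGroup.induction_on with | H y =>
  obtain ⟨v, hv, rfl⟩ := Gr.exists_mk y
  have h' := hS.inl_P2 v hv a
  have h2 := mul_mem h (inv_mem h')
  have e : (toNilQuot r u)⁻¹ * S.inl (Multiplicative.ofAdd (a, QuotientAddGroup.mk (Gr.mk v hv))) *
      ((toNilQuot r v)⁻¹ *
        S.inl (Multiplicative.ofAdd (a, QuotientAddGroup.mk (Gr.mk v hv))))⁻¹ =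
      toNilQuot r (u⁻¹ * v) := by
    rw [map_mul, map_inv]; group
  exact (QuotientAddGroup.eq.2 (mk_mem_R2 hr (mul_mem (inv_mem hu) hv) (e ▸ h2))).symm

/-- Two identifications of `γ_2 G / γ_4 G` with `M` differ by a shear. -/
theorem IsIdentification.exists_shear (hr : IsAdmissible C l r)
    {S' : GroupExtension (Multiplicative (M C l)) (NilQuot r) (H n)}
    (hS : IsIdentification C l r S) (hS' : IsIdentification C l r S') :
    ∃ f : P2 C l →+ P3 C l, ∀ m : M C l,
      S.inl (Multiplicative.ofAdd m) = S'.inl (Multiplicative.ofAdd ((shear C l f).hom m)) := by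
  have hright : S.rightHom = S'.rightHom := by
    refine MonoidHom.ext fun x => ?_
    obtain ⟨w, rfl⟩ := toNilQuot_surjective r x
    rw [hS.rightHom_eq, hS'.rightHom_eq]
  have hg : ∀ m : P3 C l × P2 C l, ∃ m' : P3 C l × P2 C l,
      S.inl (Multiplicative.ofAdd m) = S'.inl (Multiplicative.ofAdd m') := fun m => by
    obtain ⟨m', h⟩ := exists_inl_mul S' (x := S.inl (Multiplicative.ofAdd m)) (y := 1)
      (by rw [← hright, S.rightHom_inl, map_one])
    exact ⟨m', h.trans (mul_one _)⟩
  choose g hg using hg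
  have hadd : ∀ m m', g (m + m') = g m + g m' := fun m m' =>
    inl_ofAdd_injective S' ((hg _).symm.trans ((inl_add S m m').trans
      ((congrArg₂ (· * ·) (hg m) (hg m')).trans (inl_add S' _ _).symm)))
  have hfst : ∀ a, g (a, 0) = (a, 0) := fun a => by
    induction a using QuotientAddGroup.induction_on with | H x =>
    obtain ⟨u, hu, rfl⟩ := Gr.exists_mk x
    exact inl_ofAdd_injective S' ((hg _).symm.trans ((hS.inl_P3 u hu).trans
      (hS'.inl_P3 u hu).symm))
  have hsnd : ∀ b, (g (0, b)).2 = b := fun b => by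
    induction b using QuotientAddGroup.induction_on with | H y =>
    obtain ⟨v, hv, rfl⟩ := Gr.exists_mk y
    exact hS'.snd_eq hr hv (hg _ ▸ hS.inl_P2 v hv 0)
  refine ⟨AddMonoidHom.mk' (fun b => (g (0, b)).1) fun b b' => ?_, fun m => ?_⟩
  · rw [← Prod.fst_add, ← hadd, Prod.mk_add_mk, zero_add]
  · obtain ⟨a, b⟩ : P3 C l × P2 C l := m
    refine (hg (a, b)).trans (congrArg (fun z => S'.inl (Multiplicative.ofAdd z)) ?_)
    have e : g (a, b) = g (a, 0) + g (0, b) := by rw [← hadd, Prod.mk_add_mk, add_zero, zero_add]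
    rw [e, hfst]
    exact Prod.ext rfl ((zero_add _).trans (hsnd b))

/-- The class of `1 → M → G / γ_4 G → H → 1` lies over `χ_2`. -/
theorem IsIdentification.beta_class (hr : IsAdmissible C l r) (hS : IsIdentification C l r S)
    {χ : H2 (M C l)} (hχ : IsExtensionClass (M C l) S χ) :
    commutatorForm (beta C l χ) = QuotientAddGroup.mk' (R2 C l) := by
  obtain ⟨σ, c, hσ, rfl⟩ := hχ
  have h₂ : beta C l (H2π _ c) = H2π _ (mapCocycles₂ (MonoidHom.id (H n)) (projM C l) c) :=
    functor_map_H2π (projM C l) fun _ _ => rfl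
  rw [h₂]
  refine Gr.hom_ext_commutator fun u v => ?_
  rw [commutatorForm_H2π]
  change Prod.snd (c (Abelianization.of u, Abelianization.of v) : P3 C l × P2 C l) -
    Prod.snd (c (Abelianization.of v, Abelianization.of u) : P3 C l × P2 C l) = _
  rw [← Prod.snd_sub]
  have hlift : ∀ w : F n, ∃ w', toNilQuot r w' = σ (Abelianization.of w) ∧
      (Abelianization.of w : H n) = Abelianization.of w' := fun w => by
    obtain ⟨w', e⟩ := toNilQuot_surjective r (σ (Abelianization.of w))
    refine ⟨w', e, ?_⟩
    have h := hS.rightHom_eq w'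
    rwa [e, GroupExtension.Section.rightHom_section] at h
  obtain ⟨u', hu', eu⟩ := hlift u
  obtain ⟨v', hv', ev⟩ := hlift v
  rw [Gr.mk_commutator_congr eu ev]
  refine hS.snd_eq hr _ ?_
  have e : toNilQuot r ⁅u', v'⁆ = S.inl (Multiplicative.ofAdd
      (c (Abelianization.of u, Abelianization.of v) -
        c (Abelianization.of v, Abelianization.of u))) := by
    have e1 := hσ (Abelianization.of u) (Abelianization.of v)
    have e2 := hσ (Abelianization.of v) (Abelianization.of u)
    rw [mul_comm (Abelianization.of v)] at e2
    have e3 : ⁅σ (Abelianization.of u), σ (Abelianization.of v)⁆ =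
        σ (Abelianization.of u) * σ (Abelianization.of v) *
          (σ (Abelianization.of v) * σ (Abelianization.of u))⁻¹ := by
      rw [commutatorElement_def]; group
    rw [map_commutatorElement, hu', hv', e3, e1, e2, ofAdd_sub, map_div, div_eq_mul_inv]
    group
  rw [e]
  change (S.inl _)⁻¹ * S.inl _ ∈ _
  rw [inv_mul_cancel]
  exact one_mem _

theorem exists_isChi3 (hr : IsAdmissible C l r) : ∃ y, IsChi3 C l r y := by
  obtain ⟨S, hS⟩ := exists_identification hr
  obtain ⟨c, hc⟩ := exists_factorSet hS.actsByConj
    ⟨Function.surjInv S.rightHom_surjective, Function.surjInv_eq _⟩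
  have hχ : IsExtensionClass (M C l) S (H2π _ c) := ⟨_, c, hc, rfl⟩
  exact ⟨_, S, ⟨_, hS.beta_class hr hχ⟩, hS, hχ, rfl⟩

theorem IsChi3.unique (hr : IsAdmissible C l r) {y y' : Y C l} (h : IsChi3 C l r y)
    (h' : IsChi3 C l r y') : y = y' := by
  obtain ⟨S, χ, hS, hχ, rfl⟩ := h
  obtain ⟨S', χ', hS', hχ', rfl⟩ := h'
  obtain ⟨f, hf⟩ := IsIdentification.exists_shear hr hS hS'
  refine Quotient.sound ⟨f, ?_⟩
  refine IsExtensionClass.unique hS'.actsByConj ?_ hχ'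
  refine hχ.map (shear C l f) (MonoidHom.id _) hf fun x => ?_
  obtain ⟨w, rfl⟩ := toNilQuot_surjective r x
  exact (hS'.rightHom_eq w).trans (hS.rightHom_eq w).symm

/-- The invariant is transported by an isomorphism that is the identity on `H`. -/
theorem IsChi3.of_mulEquiv {y : Y C l} (h : IsChi3 C l r y) {e : NilQuot r ≃* NilQuot r'}
    (he : ExtendsCanonical e) : IsChi3 C l r' y := by
  obtain ⟨S, χ, hS, hχ, rfl⟩ := h
  have hcongr : ∀ w, (e (toNilQuot r w))⁻¹ * toNilQuot r' w ∈
      (⊤ : Subgroup (NilQuot r')).lowerCentralSeries 1 := fun w => by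
    rw [mem_lcs_one_iff, map_mul, map_inv, he w, inv_mul_cancel]
  have hlcs : ∀ (j : ℕ) {u : F n}, u ∈ (⊤ : Subgroup (F n)).lowerCentralSeries j →
      (e (toNilQuot r u))⁻¹ * toNilQuot r' u ∈
        (⊤ : Subgroup (NilQuot r')).lowerCentralSeries (j + 1) := fun j _ hu =>
    inv_mul_mem_lcs_of_congr (f := e.toMonoidHom.comp (toNilQuot r)) hcongr j hu
  have hker : ∀ x ∈ (⊤ : Subgroup (NilQuot r)).lowerCentralSeries 1, S.rightHom x = 1 := by
    intro x hx
    obtain ⟨u, hu, rfl⟩ := exists_mem_lcs_of_surjective (toNilQuot_surjective r) hx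
    rw [hS.rightHom_eq, abelianization_of_eq_one hu]
  let S' : GroupExtension (Multiplicative (M C l)) (NilQuot r') (H n) :=
    { inl := e.toMonoidHom.comp S.inl
      rightHom := S.rightHom.comp e.symm.toMonoidHom
      inl_injective := e.injective.comp S.inl_injective
      range_inl_eq_ker_rightHom := by
        ext x
        rw [MonoidHom.mem_ker]
        change _ ↔ e.symm x ∈ S.rightHom.ker
        rw [← S.range_inl_eq_ker_rightHom]
        constructor
        · rintro ⟨m, rfl⟩
          exact ⟨m, (e.symm_apply_apply _).symm⟩
        · rintro ⟨m, hm⟩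
          exact ⟨m, (congrArg e hm).trans (e.apply_symm_apply x)⟩
      rightHom_surjective := S.rightHom_surjective.comp e.symm.surjective }
  have hinl : ∀ m, S'.inl m = e (S.inl m) := fun _ => rfl
  have hright : ∀ x, S'.rightHom (e x) = S.rightHom x := fun x =>
    congrArg S.rightHom (e.symm_apply_apply x)
  have hS' : IsIdentification C l r' S' :=
    { rightHom_eq := fun w => by
        have h1 : e.symm ((e (toNilQuot r w))⁻¹ * toNilQuot r' w) ∈
            (⊤ : Subgroup (NilQuot r)).lowerCentralSeries 1 :=
          map_mem_lcs e.symm.toMonoidHom (hcongr w)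
        have h2 : S'.rightHom ((e (toNilQuot r w))⁻¹ * toNilQuot r' w) = 1 := hker _ h1
        rw [map_mul, map_inv, hright, hS.rightHom_eq, inv_mul_eq_one] at h2
        exact h2.symm
      conj_eq := fun x m => by
        obtain ⟨x, rfl⟩ := e.surjective x
        rw [hright, hinl, hinl, ← hS.conj_eq, map_mul, map_mul, map_inv]
      inl_P3 := fun u hu => by
        have h := hlcs 2 hu
        rw [lcs_three_nilQuot, Subgroup.mem_bot, inv_mul_eq_one] at h
        exact (congrArg e (hS.inl_P3 u hu)).trans h
      inl_P2 := fun u hu a => by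
        have h1 := map_mem_lcs e.toMonoidHom (hS.inl_P2 u hu a)
        have h2 := mul_mem (inv_mem (hlcs 1 hu)) h1
        have e1 : ∀ z, ((e (toNilQuot r u))⁻¹ * toNilQuot r' u)⁻¹ *
            e.toMonoidHom ((toNilQuot r u)⁻¹ * z) = (toNilQuot r' u)⁻¹ * e z := fun z => by
          change _ * e _ = _
          rw [map_mul, map_inv]; group
        rw [e1] at h2
        exact h2 }
  have hχ' : IsExtensionClass (M C l) S' ((groupCohomology.functor ℤ (H n) 2).map (𝟙 _) χ.1) :=
    hχ.map (𝟙 (M C l)) e.toMonoidHom (fun _ => rfl) hright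
  have hid : (groupCohomology.functor ℤ (H n) 2).map (𝟙 (M C l)) χ.1 = χ.1 :=
    congrArg (fun φ => φ.hom χ.1) ((groupCohomology.functor ℤ (H n) 2).map_id (M C l))
  rw [hid] at hχ'
  exact ⟨S', χ, hS', hχ', rfl⟩

/-- If the invariants agree, so do the extension classes up to a shear, and the extensions are
isomorphic. -/
theorem exists_mulEquiv_of_isChi3 {y : Y C l} (h : IsChi3 C l r y) (h' : IsChi3 C l r' y) :
    ∃ e : NilQuot r ≃* NilQuot r', ExtendsCanonical e := by
  obtain ⟨S, χ, hS, hχ, rfl⟩ := h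
  obtain ⟨S', χ', hS', hχ', hy⟩ := h'
  obtain ⟨f, hf⟩ := Quotient.exact hy.symm
  have hbij : Function.Bijective (shear C l f).hom := by
    constructor
    · intro m m' hm
      obtain ⟨h1, h2⟩ := Prod.mk.inj hm
      exact Prod.ext (add_right_cancel (h1.trans (by rw [h2]))) h2
    · intro m
      obtain ⟨a, b⟩ : P3 C l × P2 C l := m
      exact ⟨(a - f b, b), Prod.ext (sub_add_cancel a (f b)) rfl⟩
  obtain ⟨e, he⟩ := exists_mulEquiv_of_class hS.actsByConj hS'.actsByConj (shear C l f) hbij hχ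
    (show IsExtensionClass (M C l) S' (shearH2 C l f χ.1) from hf ▸ hχ')
  refine ⟨e, fun w => ?_⟩
  have hker : S'.rightHom ((e (toNilQuot r w))⁻¹ * toNilQuot r' w) = 1 := by
    rw [map_mul, map_inv, he, hS.rightHom_eq, hS'.rightHom_eq, inv_mul_cancel]
  obtain ⟨u, hu⟩ := toNilQuot_surjective r' ((e (toNilQuot r w))⁻¹ * toNilQuot r' w)
  rw [← hu, hS'.rightHom_eq, ← mem_lcs_one_iff] at hker
  have h1 := mem_lcs_one_iff.1 (map_mem_lcs (toNilQuot r') hker)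
  rwa [hu, map_mul, map_inv, inv_mul_eq_one] at h1

end Invariant

end LineArrangement


theorem theorem2p1 {L P : Type*} (C : ProjectiveConfiguration L P) (hC : C.NonDegenerate)
    {n : ℕ} (l : Fin (n + 1) ≃ L) (r r' : RelatorIndex C l → F n)
    (hr : IsAdmissible C l r) (hr' : IsAdmissible C l r') :
    IsPrincipalHomogeneous (IsTranslate C l) ∧
      ∃ (χ χ' : Y C l) (κ : T C l),
        (∀ y, IsChi3 C l r y ↔ y = χ) ∧ (∀ y, IsChi3 C l r' y ↔ y = χ') ∧
        (∀ t, IsTranslate C l t χ' χ ↔ t = κ) ∧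
        ((∃ e : NilQuot r ≃* NilQuot r', ExtendsCanonical e) ↔ κ = 0) := by
  obtain ⟨χ, hχ⟩ := exists_isChi3 hr
  obtain ⟨χ', hχ'⟩ := exists_isChi3 hr'
  have hY := isPrincipalHomogeneous_of_nonempty C l ⟨χ⟩
  obtain ⟨κ, hκ, hκu⟩ := hY.existsUnique_difference χ' χ
  refine ⟨hY, χ, χ', κ, fun y => ⟨fun h => h.unique hr hχ, fun h => h ▸ hχ⟩,
    fun y => ⟨fun h => h.unique hr' hχ', fun h => h ▸ hχ'⟩,
    fun t => ⟨hκu t, fun h => h ▸ hκ⟩, ?_, ?_⟩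
  · rintro ⟨e, he⟩
    have h : χ = χ' := (hχ.of_mulEquiv he).unique hr' hχ'
    exact (hκu 0 (h ▸ hY.zero χ)).symm
  · rintro rfl
    have h : χ = χ' := (hY.existsUnique_translate 0 χ').unique hκ (hY.zero χ')
    exact exists_mulEquiv_of_isChi3 hχ (h ▸ hχ')
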